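/- Let $\alpha>0$ and $r$ be real numbers and let $m,n,p$ be positive integers with $n-1<\alpha\le n<m$ and $1\le p\le m$. For a real sequence $(w_k)_{k\ge0}$ with $\sum_k|w_k|<\infty$ put $W(z)=\sum_{k\ge0}w_kz^k$ and, for $h>0$, $$\Delta_{x\mp,h,r}^{\alpha}f(x)=\frac1{h^\alpha}\sum_{k=0}^\infty w_k\,f\bigl(x\mp(k-r)h\bigr).$$ Let $D_{x-}^\alpha$ and $D_{x+}^\alpha$ be the left and right Riemann–Liouville derivatives on $\mathbb R$: with $\nu=\lfloor\alpha\rfloor+1$, $$D_{x-}^\alpha f(x)=\frac1{\Gamma(\nu-\alpha)}\frac{d^\nu}{dx^\nu}\int_{-\infty}^x\frac{f(\eta)}{(x-\eta)^{\alpha+1-\nu}}\,d\eta,\qquad D_{x+}^\alpha f(x)=\frac{(-1)^\nu}{\Gamma(\nu-\alpha)}\frac{d^\nu}{dx^\nu}\int_x^{\infty}\frac{f(\eta)}{(\eta-x)^{\alpha+1-\nu}}\,d\eta .$$ We say that $W$ approximates $D_{x-}^\alpha$ (respectively $D_{x+}^\alpha$) with shift $r$ and order $p$ if, for every $f\in C^{m+n+1}(\mathbb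 R)$ with $f^{(k)}\in L_1(\mathbb R)$ for $0\le k\le m+n+1$ and every $x\in\mathbb R$, the series defining $\Delta_{x-,h,r}^\alpha f(x)$ (respectively $\Delta_{x+,h,r}^\alpha f(x)$) converges absolutely for all small $h>0$ and $D_{x-}^\alpha f(x)=\Delta_{x-,h,r}^\alpha f(x)+O(h^p)$ (respectively $D_{x+}^\alpha f(x)=\Delta_{x+,h,r}^\alpha f(x)+O(h^p)$) as $h\to0^+$. Assume that $W=P^\alpha$ for a real polynomial $P(z)=\sum_{j=0}^p\beta_jz^j$, in the following sense: $W(x)=P(x)^\alpha$ for all $x\in[0,1)$, where $P\ge0$ on $[0,1)$ unless $\alpha$ is an integer, and, if $\alpha$ is an even integer, $P\ge0$ on some interval $(1-\varepsilon,1)$. Assume also that $G_r(z)=z^{-\alpha}\,W(e^{-z})\,e^{rz}$ (given by this formula, with the principal power, for $\operatorname{Re}z>0$) is analytic in $|z|\le R$ for some $R\ge1$, that is, extends analytically to this disc. Then the following are equivalent, with $\lambda=r/\alpha$: 1. $W$ approximates $D_{x-}^\alpha$ with shift $r$ and order $p$; 2. $W$ approximates $D_{x+}^\alpha$ with shift $r$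 and order $p$; 3. $\displaystyle\sum_{j=0}^p(\lambda-j)^i\beta_j=\delta_{1,i}$ for $i=0,1,\dots,p$ (with $0^0=1$ and $\delta_{1,i}$ the Kronecker delta). The system in 3 is the linear system $V\boldsymbol\beta=(0,1,0,\dots,0)^T$ with the Vandermonde matrix $V=\bigl((\lambda-j)^i\bigr)_{0\le i,j\le p}$. -/

import Mathlib

open Filter Topology MeasureTheory Asymptotics

noncomputable section

namespace GrunwaldApprox

/-- The left Riemann-Liouville fractional derivative of order `α > 0` on the whole line,
`1/Γ(n-α) dⁿ/dxⁿ ∫_{-∞}^x f(η) / (x-η)^(α+1-n) dη` with `n = [α] + 1`.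
For an integer `α` it is the ordinary derivative of order `α`. -/
def leftDeriv (α : ℝ) (f : ℝ → ℝ) (x : ℝ) : ℝ :=
  1 / Real.Gamma (((⌊α⌋₊ + 1 : ℕ) : ℝ) - α) *
    iteratedDeriv (⌊α⌋₊ + 1)
      (fun y => ∫ η in Set.Iio y, f η / (y - η) ^ (α + 1 - ((⌊α⌋₊ + 1 : ℕ) : ℝ))) x

/-- The right Riemann-Liouville fractional derivative of order `α > 0` on the whole line,
`(-1)ⁿ/Γ(n-α) dⁿ/dxⁿ ∫_x^∞ f(η) / (η-x)^(α+1-n) dη` with `n = [α] + 1`. -/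
def rightDeriv (α : ℝ) (f : ℝ → ℝ) (x : ℝ) : ℝ :=
  (-1) ^ (⌊α⌋₊ + 1) / Real.Gamma (((⌊α⌋₊ + 1 : ℕ) : ℝ) - α) *
    iteratedDeriv (⌊α⌋₊ + 1)
      (fun y => ∫ η in Set.Ioi y, f η / (η - y) ^ (α + 1 - ((⌊α⌋₊ + 1 : ℕ) : ℝ))) x

/-- The left Grünwald type operator with step `h`, shift `r` and weights `w`. -/
def leftOp (α r : ℝ) (w : ℕ → ℝ) (h : ℝ) (f : ℝ → ℝ) (x : ℝ) : ℝ :=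
  1 / h ^ α * ∑' k : ℕ, w k * f (x - ((k : ℝ) - r) * h)

/-- The right Grünwald type operator with step `h`, shift `r` and weights `w`. -/
def rightOp (α r : ℝ) (w : ℕ → ℝ) (h : ℝ) (f : ℝ → ℝ) (x : ℝ) : ℝ :=
  1 / h ^ α * ∑' k : ℕ, w k * f (x + ((k : ℝ) - r) * h)

/-- `f ∈ C^s(ℝ)` and `D^k f ∈ L₁(ℝ)` for `0 ≤ k ≤ s`. -/
def SmoothL1 (s : ℕ) (f : ℝ → ℝ) : Prop :=
  ContDiff ℝ s f ∧ ∀ k ≤ s, Integrable (iteratedDeriv k f)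

/-- The weights `w` approximate the left fractional derivative of order `α` with shift `r` and
order `p`: for every `f` of the class `SmoothL1 s` and every point `x` the series of the operator
converges for small `h > 0`, and the error is `O(h^p)` as `h → 0⁺`. -/
def ApproximatesLeft (α r : ℝ) (w : ℕ → ℝ) (p s : ℕ) : Prop :=
  ∀ f : ℝ → ℝ, SmoothL1 s f → ∀ x : ℝ,
    (∀ᶠ h in 𝓝[>] (0 : ℝ), Summable fun k : ℕ => w k * f (x - ((k : ℝ) - r) * h)) ∧
    (fun h : ℝ => leftDeriv α f x - leftOp α r w h f x) =O[𝓝[>] 0] fun h : ℝ => h ^ p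

/-- The same for the right fractional derivative. -/
def ApproximatesRight (α r : ℝ) (w : ℕ → ℝ) (p s : ℕ) : Prop :=
  ∀ f : ℝ → ℝ, SmoothL1 s f → ∀ x : ℝ,
    (∀ᶠ h in 𝓝[>] (0 : ℝ), Summable fun k : ℕ => w k * f (x + ((k : ℝ) - r) * h)) ∧
    (fun h : ℝ => rightDeriv α f x - rightOp α r w h f x) =O[𝓝[>] 0] fun h : ℝ => h ^ p

/-- The value `β₀ + β₁ x + ⋯ + β_p x^p`. -/
def polyVal {p : ℕ} (β : Fin (p + 1) → ℝ) (x : ℝ) : ℝ := ∑ j, β j * x ^ (j : ℕ)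

/-- The generating function `∑ w_k z^k` of the real sequence `w` is the power `P(z)^α` of the
polynomial `P` with coefficients `β`.
The two agree as real functions on `[0, 1)`, which determines `w`: the `w_k` are the Taylor
coefficients of `P^α` at `0`. The power is an honest one: either `P ≥ 0` on `[0, 1)` (the real
power of a nonnegative number) or `α` is a natural number. As `P` and `-P` have the same even
powers, in that case `P` is the base that is nonnegative to the left of `1`. -/
def IsPowerGF {p : ℕ} (α : ℝ) (β : Fin (p + 1) → ℝ) (w : ℕ → ℝ) : Prop :=
  (∀ x ∈ Set.Ico (0 : ℝ) 1, HasSum (fun k : ℕ => w k * x ^ k) (polyVal β x ^ α)) ∧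
  ((∀ x ∈ Set.Ico (0 : ℝ) 1, 0 ≤ polyVal β x) ∨ ∃ N : ℕ, α = N) ∧
  (∀ N : ℕ, α = N → Even N → ∀ᶠ x in 𝓝[<] (1 : ℝ), 0 ≤ polyVal β x)

/-- `G_r(z) = z^(-α) W(e^(-z)) e^(rz)`, where `W(z) = ∑ w_k z^k`, is analytic in `|z| ≤ R` for
some `R ≥ 1`: it has an analytic extension from the part of the disc with `Re z > 0`, where the
series converges (there `z^α` is the principal power), to the closed disc. -/
def HasAnalyticSymbol (α r : ℝ) (w : ℕ → ℝ) : Prop :=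
  ∃ R : ℝ, 1 ≤ R ∧ ∃ G : ℂ → ℂ, AnalyticOnNhd ℂ G (Metric.closedBall 0 R) ∧
    ∀ z : ℂ, 0 < z.re → ‖z‖ ≤ R →
      G z = 1 / z ^ (α : ℂ) * (∑' k : ℕ, (w k : ℂ) * Complex.exp (-z) ^ k) *
        Complex.exp ((r : ℂ) * z)

end GrunwaldApprox

end

namespace GrunwaldApprox

/-! All conditions are compared with one real asymptotic statement about the symbol S(x) = W(e^(-x))
e^(rx): S(x) - x^α = O(x^(α+p)) as x → 0+.

Algebraic side (`realSymbol_isBigO_iff`). With λ = r/α put Q(x) = P(e^(-x)) e^(λx) = ∑ β_j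
e^((λ-j)x), so that S = Q^α wherever Q ≥ 0. Taking α-th powers or roots near 1 preserves relative
errors, so the asymptotic statement says Q(x) = x + O(x^(p+1)). Comparing Taylor coefficients at 0
gives exactly the Vandermonde system.

Analytic side, α < n (`approximatesLeft_iff_of_lt`). On the Fourier side the left derivative is the
multiplier (2πiω)^α and the Grünwald operator is h^(-α) S(2πiωh). If G_r has Taylor coefficients
g_k, the error of the operator is ∑_{k<p} h^k (δ_{k,0} - g_k) D^(α+k) f + O(h^p). Hence order p
means g_k = δ_{k,0} for k < p; read on the positive axis, this is the asymptotic statement again.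

Analytic side, α = n (`approximatesLeft_natCast_iff`). The weights are the coefficients of the
polynomial P^n, so the operator is a finite sum, and Taylor's formula for f replaces Fourier
analysis.

The right derivative reduces to the left one by the reflection x ↦ -x. -/

/-! ### Coefficient extraction and exponential sums. -/

/-- Letting t → 0+ kills the constant term; division by t then lowers p by one. -/
theorem eq_zero_of_sum_pow_smul_isBigO {E : Type*} [NormedAddCommGroup E] [NormedSpace ℝ E]
    (p : ℕ) (b : ℕ → E)
    (h : (fun t : ℝ => ∑ k ∈ Finset.range p, t ^ k • b k) =O[𝓝[>] 0] fun t : ℝ => t ^ p) :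
    ∀ k < p, b k = 0 := by
  induction p generalizing b with
  | zero => simp
  | succ p ih =>
    have hlim : Tendsto (fun t : ℝ => ∑ k ∈ Finset.range (p + 1), t ^ k • b k) (𝓝[>] 0)
        (𝓝 (∑ k ∈ Finset.range (p + 1), (0 : ℝ) ^ k • b k)) := by
      apply Tendsto.mono_left _ nhdsWithin_le_nhds
      exact Continuous.tendsto (by fun_prop) 0
    have hlim' : Tendsto (fun t : ℝ => ∑ k ∈ Finset.range (p + 1), t ^ k • b k) (𝓝[>] 0) (𝓝 0) := by
      apply h.trans_tendsto
      apply Tendsto.mono_left _ nhdsWithin_le_nhds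
      exact (Continuous.tendsto' (by fun_prop) 0 0 (by simp))
    have h0 : b 0 = 0 := by
      have := tendsto_nhds_unique hlim hlim'
      simpa [Finset.sum_range_succ'] using this
    have hs := ih (fun k => b (k + 1)) (by
      have h1 : (fun t : ℝ => t⁻¹ • ∑ k ∈ Finset.range (p + 1), t ^ k • b k)
          =O[𝓝[>] 0] fun t : ℝ => t⁻¹ • t ^ (p + 1) := (isBigO_refl _ _).smul h
      refine h1.congr' ?_ ?_
      · filter_upwards [self_mem_nhdsWithin] with t (ht : 0 < t)
        rw [Finset.sum_range_succ', h0, smul_zero, add_zero, Finset.smul_sum]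
        refine Finset.sum_congr rfl fun k _ => ?_
        rw [smul_smul, pow_succ']
        congr 1
        field_simp
      · filter_upwards [self_mem_nhdsWithin] with t (ht : 0 < t)
        rw [smul_eq_mul, pow_succ']
        field_simp)
    rintro (_ | k) hk
    · exact h0
    · exact hs k (by omega)

theorem sub_taylor_isBigO {φ : ℝ → ℝ} {N : ℕ} (hφ : ContDiff ℝ N φ) (x : ℝ) :
    (fun t : ℝ => φ (x + t) - ∑ i ∈ Finset.range N, t ^ i * (iteratedDeriv i φ x / i.factorial))
      =O[𝓝 0] fun t : ℝ => t ^ N := by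
  have h1 := (taylor_isLittleO_univ (x₀ := x) hφ).isBigO
  have h2 : Tendsto (fun t : ℝ => x + t) (𝓝 0) (𝓝 x) :=
    Continuous.tendsto' (by fun_prop) 0 x (by simp)
  have h3 := h1.comp_tendsto h2
  -- The degree-N Taylor term is moved into the error, so N continuous derivatives suffice.
  have h4 : (fun t : ℝ => t ^ N * (iteratedDeriv N φ x / N.factorial)) =O[𝓝 0]
      fun t : ℝ => t ^ N := by
    simpa [mul_comm] using (isBigO_refl (fun t : ℝ => t ^ N) (𝓝 0)).const_mul_left
      (iteratedDeriv N φ x / N.factorial)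
  refine ((h3.congr_right (g₂ := fun t : ℝ => t ^ N) ?_).add h4).congr_left ?_
  · intro t; simp
  · intro t
    simp only [Function.comp, taylor_within_apply, iteratedDerivWithin_univ, smul_eq_mul,
      add_sub_cancel_left]
    rw [Finset.sum_range_succ, ← sub_sub]
    have : ∀ i : ℕ, (i.factorial : ℝ)⁻¹ * t ^ i * iteratedDeriv i φ x
        = t ^ i * (iteratedDeriv i φ x / i.factorial) := fun i => by ring
    simp only [this]
    ring

theorem sum_comp_sub_taylor_isBigO {ι : Type*} (s : Finset ι) (a c : ι → ℝ) {φ : ℝ → ℝ} {N : ℕ}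
    (hφ : ContDiff ℝ N φ) (x : ℝ) :
    (fun t : ℝ => ∑ j ∈ s, a j * φ (x + c j * t) - ∑ i ∈ Finset.range N,
        t ^ i * (iteratedDeriv i φ x / i.factorial * ∑ j ∈ s, a j * c j ^ i))
      =O[𝓝[>] 0] fun t : ℝ => t ^ N := by
  have h1 : ∀ j ∈ s, (fun t : ℝ => a j * (φ (x + c j * t) - ∑ i ∈ Finset.range N,
      (c j * t) ^ i * (iteratedDeriv i φ x / i.factorial))) =O[𝓝[>] 0] fun t : ℝ => t ^ N := by
    intro j _
    apply IsBigO.const_mul_left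
    have h2 : Tendsto (fun t : ℝ => c j * t) (𝓝[>] 0) (𝓝 0) :=
      Tendsto.mono_left (Continuous.tendsto' (by fun_prop) 0 0 (by simp)) nhdsWithin_le_nhds
    refine ((sub_taylor_isBigO hφ x).comp_tendsto h2).trans ?_
    simp only [Function.comp_def, mul_pow]
    exact (isBigO_refl _ _).const_mul_left _
  refine (IsBigO.fun_sum h1).congr_left fun t => ?_
  simp only [mul_sub, Finset.sum_sub_distrib, Finset.mul_sum]
  congr 1
  rw [Finset.sum_comm]
  refine Finset.sum_congr rfl fun i _ => Finset.sum_congr rfl fun j _ => ?_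
  ring

theorem sum_exp_isBigO {ι : Type*} (s : Finset ι) (a c : ι → ℝ) (N : ℕ) :
    (fun t : ℝ => ∑ j ∈ s, a j * Real.exp (c j * t) - ∑ i ∈ Finset.range N,
        t ^ i * ((∑ j ∈ s, a j * c j ^ i) / i.factorial)) =O[𝓝[>] 0] fun t : ℝ => t ^ N := by
  refine (sum_comp_sub_taylor_isBigO s a c (φ := Real.exp) (N := N) Real.contDiff_exp 0).congr_left
    fun t => ?_
  simp only [zero_add, iteratedDeriv_eq_iterate, Real.iter_deriv_exp, Real.exp_zero]
  congr 1
  refine Finset.sum_congr rfl fun i _ => ?_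
  ring

/-- An exponential sum is `t ^ d` up to `O(t ^ N)` exactly when its moments say so. -/
theorem sum_exp_sub_pow_isBigO_iff {ι : Type*} (s : Finset ι) (a c : ι → ℝ) {d N : ℕ}
    (hd : d < N) :
    ((fun t : ℝ => ∑ j ∈ s, a j * Real.exp (c j * t) - t ^ d) =O[𝓝[>] 0] fun t : ℝ => t ^ N) ↔
      ∀ i < N, (∑ j ∈ s, a j * c j ^ i) / i.factorial = if i = d then 1 else 0 := by
  have h0 := sum_exp_isBigO s a c N
  have hsum : ∀ t : ℝ, ∑ i ∈ Finset.range N, t ^ i * (if i = d then (1 : ℝ) else 0) = t ^ d := by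
    intro t
    simp [hd]
  constructor
  · intro h
    have h1 : (fun t : ℝ => ∑ i ∈ Finset.range N,
        t ^ i • ((∑ j ∈ s, a j * c j ^ i) / i.factorial - if i = d then 1 else 0))
          =O[𝓝[>] 0] fun t : ℝ => t ^ N := by
      refine (h.sub h0).congr_left fun t => ?_
      simp only [smul_eq_mul, mul_sub, Finset.sum_sub_distrib, hsum]
      ring
    intro i hi
    exact sub_eq_zero.1 (eq_zero_of_sum_pow_smul_isBigO N _ h1 i hi)
  · intro h
    refine h0.congr_left fun t => ?_
    congr 1
    rw [← hsum t]
    refine Finset.sum_congr rfl fun i hi => ?_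
    rw [h i (Finset.mem_range.1 hi)]

/-! ### The real symbol and the moment system. -/

/-- The symbol `W(e^(-x)) e^(rx)` on the positive half-line. -/
noncomputable def realSymbol (r : ℝ) (w : ℕ → ℝ) (x : ℝ) : ℝ :=
  (∑' k : ℕ, w k * Real.exp (-x) ^ k) * Real.exp (r * x)

theorem exp_neg_mem_Ico {x : ℝ} (hx : 0 < x) : Real.exp (-x) ∈ Set.Ico (0 : ℝ) 1 :=
  ⟨(Real.exp_pos _).le, by simpa using hx⟩

/-- Differentiability of the power at 1. It is applied with exponent α and with exponent 1/α, which
makes the passage between Q and Q^α reversible. -/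
theorem rpow_sub_one_isBigO {u : ℝ → ℝ} {l : Filter ℝ} (a : ℝ) (hu : Tendsto u l (𝓝 1)) :
    (fun x => u x ^ a - 1) =O[l] fun x => u x - 1 := by
  have h : HasDerivAt (fun y : ℝ => y ^ a) (a * 1 ^ (a - 1)) 1 :=
    Real.hasDerivAt_rpow_const (Or.inl one_ne_zero)
  simpa [Function.comp_def] using h.isBigO_sub.comp_tendsto hu

/-- If `S = Q ^ α` with `Q ≥ 0`, then `S ∼ x ^ α` up to relative order `p` iff
`Q ∼ x` up to relative order `p`. -/
theorem rpow_isBigO_iff {α : ℝ} (hα : 0 < α) {p : ℕ} (hp : 1 ≤ p) {Q : ℝ → ℝ}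
    (hQ : ∀ᶠ x in 𝓝[>] (0 : ℝ), 0 ≤ Q x) :
    ((fun x => Q x ^ α - x ^ α) =O[𝓝[>] 0] fun x : ℝ => x ^ (α + p)) ↔
      (fun x => Q x - x ^ 1) =O[𝓝[>] 0] fun x : ℝ => x ^ (p + 1) := by
  have hpt : Tendsto (fun x : ℝ => x ^ p) (𝓝[>] 0) (𝓝 0) :=
    Tendsto.mono_left (Continuous.tendsto' (by fun_prop) 0 0 (by simp; omega)) nhdsWithin_le_nhds
  -- Both statements are normalised to relative errors of Q(x)/x, a quantity tending to 1.
  have key1 : ((fun x => Q x ^ α - x ^ α) =O[𝓝[>] 0] fun x : ℝ => x ^ (α + p)) ↔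
      (fun x => (Q x / x) ^ α - 1) =O[𝓝[>] 0] fun x : ℝ => x ^ p := by
    constructor
    · intro h
      refine ((isBigO_refl (fun x : ℝ => (x ^ α)⁻¹) _).mul h).congr' ?_ ?_
      · filter_upwards [hQ, self_mem_nhdsWithin] with x hx (hx0 : 0 < x)
        have := Real.rpow_pos_of_pos hx0 α
        rw [Real.div_rpow hx hx0.le]
        field_simp
      · filter_upwards [self_mem_nhdsWithin] with x (hx0 : 0 < x)
        have := Real.rpow_pos_of_pos hx0 α
        rw [Real.rpow_add hx0, Real.rpow_natCast]
        field_simp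
    · intro h
      refine ((isBigO_refl (fun x : ℝ => (x ^ α)) _).mul h).congr' ?_ ?_
      · filter_upwards [hQ, self_mem_nhdsWithin] with x hx (hx0 : 0 < x)
        have := Real.rpow_pos_of_pos hx0 α
        rw [Real.div_rpow hx hx0.le]
        field_simp
      · filter_upwards [self_mem_nhdsWithin] with x (hx0 : 0 < x)
        rw [Real.rpow_add hx0, Real.rpow_natCast]
  have key2 : ((fun x => Q x - x ^ 1) =O[𝓝[>] 0] fun x : ℝ => x ^ (p + 1)) ↔
      (fun x => Q x / x - 1) =O[𝓝[>] 0] fun x : ℝ => x ^ p := by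
    constructor
    · intro h
      refine ((isBigO_refl (fun x : ℝ => x⁻¹) _).mul h).congr' ?_ ?_
      · filter_upwards [self_mem_nhdsWithin] with x (hx0 : 0 < x)
        field_simp
      · filter_upwards [self_mem_nhdsWithin] with x (hx0 : 0 < x)
        rw [pow_succ]
        field_simp
    · intro h
      refine ((isBigO_refl (fun x : ℝ => x) _).mul h).congr' ?_ ?_
      · filter_upwards [self_mem_nhdsWithin] with x (hx0 : 0 < x)
        field_simp
      · filter_upwards [self_mem_nhdsWithin] with x (hx0 : 0 < x)
        ring
  rw [key1, key2]
  constructor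
  · intro h
    have hu : Tendsto (fun x => (Q x / x) ^ α) (𝓝[>] 0) (𝓝 1) := by
      simpa using (h.trans_tendsto hpt).add_const 1
    refine ((rpow_sub_one_isBigO α⁻¹ hu).trans h).congr' ?_ EventuallyEq.rfl
    filter_upwards [hQ, self_mem_nhdsWithin] with x hx (hx0 : 0 < x)
    rw [Real.rpow_rpow_inv (by positivity) hα.ne']
  · intro h
    have hu : Tendsto (fun x => Q x / x) (𝓝[>] 0) (𝓝 1) := by
      simpa using (h.trans_tendsto hpt).add_const 1
    exact (rpow_sub_one_isBigO α hu).trans h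

theorem realSymbol_isBigO_iff {α r : ℝ} (hα : 0 < α) {p : ℕ} (hp : 1 ≤ p)
    {β : Fin (p + 1) → ℝ} {w : ℕ → ℝ} (hW : IsPowerGF α β w) :
    ((fun x => realSymbol r w x - x ^ α) =O[𝓝[>] 0] fun x : ℝ => x ^ (α + p)) ↔
      ∀ i : ℕ, i ≤ p →
        ∑ j : Fin (p + 1), (r / α - ((j : ℕ) : ℝ)) ^ i * β j = if i = 1 then (1 : ℝ) else 0 := by
  obtain ⟨hW1, hW2, hW3⟩ := hW
  set Q : ℝ → ℝ := fun x => ∑ j : Fin (p + 1), β j * Real.exp ((r / α - ((j : ℕ) : ℝ)) * x) with hQd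
  have hQ : ∀ x, Q x = polyVal β (Real.exp (-x)) * Real.exp (r / α * x) := by
    intro x
    simp only [hQd, polyVal, Finset.sum_mul, mul_assoc]
    refine Finset.sum_congr rfl fun j _ => ?_
    rw [← Real.exp_nat_mul, ← Real.exp_add]
    ring_nf
  have hS : ∀ x, 0 < x → realSymbol r w x = polyVal β (Real.exp (-x)) ^ α * Real.exp (r * x) := by
    intro x hx
    rw [realSymbol, (hW1 _ (exp_neg_mem_Ico hx)).tsum_eq]
  have hSQ : ∀ x, 0 < x → 0 ≤ Q x → realSymbol r w x = Q x ^ α := by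
    intro x hx h0
    have h1 : 0 ≤ polyVal β (Real.exp (-x)) := by
      rw [hQ] at h0
      exact nonneg_of_mul_nonneg_left h0 (Real.exp_pos _)
    rw [hS x hx, hQ, Real.mul_rpow h1 (Real.exp_pos _).le, ← Real.exp_mul]
    congr 2
    field_simp
  have hpt : Tendsto (fun x : ℝ => x ^ p) (𝓝[>] 0) (𝓝 0) :=
    Tendsto.mono_left (Continuous.tendsto' (by fun_prop) 0 0 (by simp; omega)) nhdsWithin_le_nhds
  have hexp : Tendsto (fun x : ℝ => Real.exp (-x)) (𝓝[>] 0) (𝓝[<] 1) := by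
    apply tendsto_nhdsWithin_of_tendsto_nhds_of_eventually_within
    · exact Tendsto.mono_left (Continuous.tendsto' (by fun_prop) 0 1 (by simp)) nhdsWithin_le_nhds
    · filter_upwards [self_mem_nhdsWithin] with x hx using (exp_neg_mem_Ico hx).2
  -- S = Q^α needs Q ≥ 0 near 0, which is obtained separately from each side of the equivalence.
  -- Here it is a hypothesis on P, except for odd integer α: then S(x)/x^α → 1 makes S positive, and
  -- a positive odd power has a positive base.
  have hpos1 : ((fun x => realSymbol r w x - x ^ α) =O[𝓝[>] 0] fun x : ℝ => x ^ (α + p)) →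
      ∀ᶠ x in 𝓝[>] (0 : ℝ), 0 ≤ Q x := by
    intro h
    have conv : (∀ᶠ x in 𝓝[>] (0 : ℝ), 0 ≤ polyVal β (Real.exp (-x))) →
        ∀ᶠ x in 𝓝[>] (0 : ℝ), 0 ≤ Q x := by
      intro h
      filter_upwards [h] with x hx
      rw [hQ]
      positivity
    apply conv
    rcases hW2 with h2 | ⟨N, hN⟩
    · filter_upwards [self_mem_nhdsWithin] with x hx using h2 _ (exp_neg_mem_Ico hx)
    rcases Nat.even_or_odd N with hev | hodd
    · exact hexp.eventually (hW3 N hN hev)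
    · have h1 : (fun x => (x ^ α)⁻¹ * (realSymbol r w x - x ^ α)) =O[𝓝[>] 0] fun x : ℝ => x ^ p := by
        refine ((isBigO_refl (fun x : ℝ => (x ^ α)⁻¹) _).mul h).congr' EventuallyEq.rfl ?_
        filter_upwards [self_mem_nhdsWithin] with x (hx0 : 0 < x)
        have := Real.rpow_pos_of_pos hx0 α
        rw [Real.rpow_add hx0, Real.rpow_natCast]
        field_simp
      have h2 := h1.trans_tendsto hpt
      filter_upwards [self_mem_nhdsWithin, h2.eventually (lt_mem_nhds (by norm_num : (-1 : ℝ) < 0))]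
        with x (hx0 : 0 < x) hx
      have hxa := Real.rpow_pos_of_pos hx0 α
      have h3 : 0 < realSymbol r w x := by
        rw [mul_sub, inv_mul_cancel₀ hxa.ne'] at hx
        have : 0 < (x ^ α)⁻¹ * realSymbol r w x := by linarith
        exact (mul_pos_iff_of_pos_left (inv_pos.2 hxa)).1 this
      rw [hS x hx0] at h3
      have h4 := (mul_pos_iff_of_pos_right (Real.exp_pos _)).1 h3
      rw [hN, Real.rpow_natCast] at h4
      exact (hodd.pow_pos_iff.1 h4).le
  -- From the other side, Q(x)/x → 1 gives the sign directly.
  have hpos2 : ((fun x => Q x - x ^ 1) =O[𝓝[>] 0] fun x : ℝ => x ^ (p + 1)) →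
      ∀ᶠ x in 𝓝[>] (0 : ℝ), 0 ≤ Q x := by
    intro h
    have h1 : (fun x => x⁻¹ * (Q x - x ^ 1)) =O[𝓝[>] 0] fun x : ℝ => x ^ p := by
      refine ((isBigO_refl (fun x : ℝ => x⁻¹) _).mul h).congr' EventuallyEq.rfl ?_
      filter_upwards [self_mem_nhdsWithin] with x (hx0 : 0 < x)
      rw [pow_succ]
      field_simp
    filter_upwards [self_mem_nhdsWithin,
      (h1.trans_tendsto hpt).eventually (lt_mem_nhds (by norm_num : (-1 : ℝ) < 0))]
      with x (hx0 : 0 < x) hx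
    rw [pow_one, mul_sub, inv_mul_cancel₀ hx0.ne'] at hx
    have : 0 < x⁻¹ * Q x := by linarith
    exact ((mul_pos_iff_of_pos_left (inv_pos.2 hx0)).1 this).le
  have hSQe : (∀ᶠ x in 𝓝[>] (0 : ℝ), 0 ≤ Q x) →
      (fun x => realSymbol r w x - x ^ α) =ᶠ[𝓝[>] 0] fun x => Q x ^ α - x ^ α := by
    intro h
    filter_upwards [h, self_mem_nhdsWithin] with x hx hx0
    rw [hSQ x hx0 hx]
  have hsys : (∀ i : ℕ, i ≤ p →
        ∑ j : Fin (p + 1), (r / α - ((j : ℕ) : ℝ)) ^ i * β j = if i = 1 then (1 : ℝ) else 0) ↔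
      (fun x => Q x - x ^ 1) =O[𝓝[>] 0] fun x : ℝ => x ^ (p + 1) := by
    rw [sum_exp_sub_pow_isBigO_iff Finset.univ β (fun j => r / α - ((j : ℕ) : ℝ))
      (show 1 < p + 1 by omega)]
    refine forall_congr' fun i => imp_congr (by omega) ?_
    have hf : (i.factorial : ℝ) ≠ 0 := by positivity
    simp only [mul_comm (β _)]
    rw [div_eq_iff hf]
    split_ifs with hi
    · subst hi; simp
    · simp
  rw [hsys]
  constructor
  · intro h
    exact (rpow_isBigO_iff hα hp (hpos1 h)).1 (h.congr' (hSQe (hpos1 h)) EventuallyEq.rfl)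
  · intro h
    exact ((rpow_isBigO_iff hα hp (hpos2 h)).2 h).congr' (hSQe (hpos2 h)).symm EventuallyEq.rfl

/-! ### Integer order: polynomial weights and Taylor expansion. -/

/-- The partial sum is minus the tail, and the tail is at most x^(k+1) ∑ |u_i|. -/
theorem sum_pow_isBigO_of_hasSum_zero {u : ℕ → ℝ} (hu : Summable fun k => |u k|)
    (h : ∀ x ∈ Set.Ico (0 : ℝ) 1, HasSum (fun k => u k * x ^ k) 0) (k : ℕ) :
    (fun t : ℝ => ∑ i ∈ Finset.range (k + 1), t ^ i • u i) =O[𝓝[>] 0]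
      fun t : ℝ => t ^ (k + 1) := by
  refine IsBigO.of_bound (∑' i, |u i|) ?_
  filter_upwards [Ioo_mem_nhdsGT (zero_lt_one' ℝ)] with x hx
  have h1 := h x ⟨hx.1.le, hx.2⟩
  have h2 := h1.summable.sum_add_tsum_nat_add (k + 1)
  rw [h1.tsum_eq] at h2
  have hsum : Summable fun i => |u (i + (k + 1))| := (summable_nat_add_iff (f := fun i => |u i|) (k + 1)).2 hu
  have h3 : ‖∑' i, u (i + (k + 1)) * x ^ (i + (k + 1))‖ ≤ ∑' i, |u (i + (k + 1))| * x ^ (k + 1) := by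
    refine tsum_of_norm_bounded (hsum.mul_right _).hasSum fun i => ?_
    rw [norm_mul, Real.norm_eq_abs, Real.norm_eq_abs, abs_of_nonneg (pow_nonneg hx.1.le _)]
    exact mul_le_mul_of_nonneg_left (pow_le_pow_of_le_one hx.1.le hx.2.le (by omega)) (abs_nonneg _)
  have h4 : ∑ i ∈ Finset.range (k + 1), x ^ i • u i
      = -∑' i, u (i + (k + 1)) * x ^ (i + (k + 1)) := by
    rw [eq_neg_iff_add_eq_zero, ← h2]
    simp only [smul_eq_mul, mul_comm]
  rw [h4, norm_neg]
  refine h3.trans ?_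
  rw [tsum_mul_right, Real.norm_eq_abs, abs_of_nonneg (pow_nonneg hx.1.le _)]
  refine mul_le_mul_of_nonneg_right ?_ (pow_nonneg hx.1.le _)
  have h5 := hu.sum_add_tsum_nat_add (k + 1)
  have h6 : 0 ≤ ∑ i ∈ Finset.range (k + 1), |u i| := Finset.sum_nonneg fun i _ => abs_nonneg _
  linarith

theorem eq_zero_of_hasSum_pow_zero {u : ℕ → ℝ} (hu : Summable fun k => |u k|)
    (h : ∀ x ∈ Set.Ico (0 : ℝ) 1, HasSum (fun k => u k * x ^ k) 0) : u = 0 := by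
  funext k
  exact eq_zero_of_sum_pow_smul_isBigO (k + 1) u (sum_pow_isBigO_of_hasSum_zero hu h k) k
    k.lt_succ_self

/-- For a natural exponent P^n is itself a polynomial, and uniqueness of power series coefficients
identifies w with its coefficients. -/
theorem exists_weights_eventually_zero {p : ℕ} {n : ℕ} {β : Fin (p + 1) → ℝ} {w : ℕ → ℝ}
    (hsum : Summable fun k => |w k|) (hW : IsPowerGF (n : ℝ) β w) :
    ∃ K : ℕ, ∀ k, k ∉ Finset.range K → w k = 0 := by
  let P : Polynomial ℝ := ∑ j : Fin (p + 1), Polynomial.C (β j) * Polynomial.X ^ (j : ℕ)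
  have hP : ∀ x, (P ^ n).eval x = polyVal β x ^ n := by
    intro x
    simp [P, polyVal, Polynomial.eval_finsetSum]
  have hvan : ∀ k, k ∉ Finset.range ((P ^ n).natDegree + 1) → (P ^ n).coeff k = 0 := by
    intro k hk
    exact Polynomial.coeff_eq_zero_of_natDegree_lt (by rw [Finset.mem_range] at hk; omega)
  have hw : (fun k => w k - (P ^ n).coeff k) = 0 := by
    apply eq_zero_of_hasSum_pow_zero
    · have h1 : Summable fun k => (P ^ n).coeff k := summable_of_ne_finset_zero hvan
      exact ((summable_abs_iff.1 hsum).sub h1).abs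
    · intro x hx
      have h1 := hW.1 x hx
      rw [Real.rpow_natCast, ← hP] at h1
      have h2 : HasSum (fun k => (P ^ n).coeff k * x ^ k) ((P ^ n).eval x) := by
        rw [Polynomial.eval_eq_sum_range]
        exact hasSum_sum_of_ne_finset_zero fun k hk => by rw [hvan k hk, zero_mul]
      simpa [sub_mul] using h1.sub h2
  refine ⟨(P ^ n).natDegree + 1, fun k hk => ?_⟩
  have := congrFun hw k
  rw [Pi.zero_apply, hvan k hk, sub_zero] at this
  exact this

/-- Here ν = n + 1, so the kernel exponent is 0 and Γ(ν - α) = Γ(1) = 1: the integral is a primitive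
of f, and one of the n + 1 derivatives undoes it. -/
theorem leftDeriv_natCast (n : ℕ) {f : ℝ → ℝ} (hf : Continuous f) (hi : Integrable f) (x : ℝ) :
    leftDeriv (n : ℝ) f x = iteratedDeriv n f x := by
  have hF : ∀ y, ∫ η in Set.Iio y, f η / (y - η) ^ ((n : ℝ) + 1 - ((n + 1 : ℕ) : ℝ))
      = (∫ η in Set.Iic (0 : ℝ), f η) + ∫ η in (0 : ℝ)..y, f η := by
    intro y
    have : (n : ℝ) + 1 - ((n + 1 : ℕ) : ℝ) = 0 := by push_cast; ring
    rw [this]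
    simp only [Real.rpow_zero, div_one]
    rw [← integral_Iic_eq_integral_Iio,
      ← intervalIntegral.integral_Iic_sub_Iic hi.integrableOn hi.integrableOn]
    ring
  have hd : deriv (fun y => (∫ η in Set.Iic (0 : ℝ), f η) + ∫ η in (0 : ℝ)..y, f η) = f := by
    funext y
    rw [deriv_const_add]
    exact hf.deriv_integral f 0 y
  rw [leftDeriv, Nat.floor_natCast]
  simp only [hF]
  rw [iteratedDeriv_succ', hd]
  have : ((n + 1 : ℕ) : ℝ) - n = 1 := by push_cast; ring
  rw [this, Real.Gamma_one]
  simp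

/-- A compactly supported smooth function equal to `exp` near `0`. -/
theorem exists_smooth_eventuallyEq_exp :
    ∃ f : ℝ → ℝ, (∀ s : ℕ, SmoothL1 s f) ∧ f =ᶠ[𝓝 0] Real.exp := by
  let b : ContDiffBump (0 : ℝ) := ⟨1, 2, one_pos, one_lt_two⟩
  have hc : ∀ s : ℕ, ContDiff ℝ s fun x => b x * Real.exp x := fun s =>
    b.contDiff.mul Real.contDiff_exp
  have hs : HasCompactSupport fun x => b x * Real.exp x := b.hasCompactSupport.mul_right
  refine ⟨fun x => b x * Real.exp x, fun s => ⟨hc s, fun k hk => ?_⟩, ?_⟩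
  · refine Continuous.integrable_of_hasCompactSupport ((hc s).continuous_iteratedDeriv k
      (by exact_mod_cast hk)) ?_
    clear hk
    induction k with
    | zero => simpa using hs
    | succ k ih => rw [iteratedDeriv_succ]; exact ih.deriv
  · filter_upwards [b.eventuallyEq_one] with x hx
    simp [hx]

/-- Both sides amount to the moment conditions ∑ w_k (r-k)^i / i! = δ_{i,n} for i < n + p: one by
expanding f(x + (r-k)h) in h, the other by expanding e^((r-k)x). -/
theorem approximatesLeft_natCast_iff {n p m : ℕ} {r : ℝ} (hp : 1 ≤ p) (hpm : p ≤ m)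
    {w : ℕ → ℝ} {K : ℕ} (hK : ∀ k, k ∉ Finset.range K → w k = 0) :
    ApproximatesLeft (n : ℝ) r w p (m + n + 1) ↔
      (fun x => realSymbol r w x - x ^ (n : ℝ)) =O[𝓝[>] 0] fun x : ℝ => x ^ ((n : ℝ) + p) := by
  have hsymb : ∀ x, realSymbol r w x = ∑ k ∈ Finset.range K, w k * Real.exp ((r - k) * x) := by
    intro x
    rw [realSymbol, tsum_eq_sum fun k hk => by rw [hK k hk, zero_mul], Finset.sum_mul]
    refine Finset.sum_congr rfl fun k _ => ?_
    rw [mul_assoc, ← Real.exp_nat_mul, ← Real.exp_add]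
    ring_nf
  have hR : ((fun x => realSymbol r w x - x ^ (n : ℝ)) =O[𝓝[>] 0] fun x : ℝ => x ^ ((n : ℝ) + p)) ↔
      ∀ i < n + p, (∑ k ∈ Finset.range K, w k * (r - k) ^ i) / i.factorial
        = if i = n then 1 else 0 := by
    rw [← sum_exp_sub_pow_isBigO_iff _ _ _ (show n < n + p by omega)]
    simp only [hsymb, ← Nat.cast_add, Real.rpow_natCast]
  have hop : ∀ (f : ℝ → ℝ) (x h : ℝ), leftOp n r w h f x
      = (h ^ n)⁻¹ * ∑ k ∈ Finset.range K, w k * f (x + (r - k) * h) := by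
    intro f x h
    rw [leftOp, tsum_eq_sum fun k hk => by rw [hK k hk, zero_mul], Real.rpow_natCast, one_div]
    congr 1
    refine Finset.sum_congr rfl fun k _ => ?_
    ring_nf
  have hmain : ∀ f : ℝ → ℝ, SmoothL1 (m + n + 1) f → ∀ x,
      (fun h : ℝ => h ^ n * (leftDeriv n f x - leftOp n r w h f x) -
        ∑ i ∈ Finset.range (n + p), h ^ i • (iteratedDeriv i f x * ((if i = n then 1 else 0) -
          (∑ k ∈ Finset.range K, w k * (r - k) ^ i) / i.factorial))) =O[𝓝[>] 0]
        fun h : ℝ => h ^ (n + p) := by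
    intro f hf x
    have hfN : ContDiff ℝ (n + p : ℕ) f := hf.1.of_le (by norm_cast; omega)
    have hfi : Integrable f := by simpa using hf.2 0 (by omega)
    have h1 := sum_comp_sub_taylor_isBigO (Finset.range K) w (fun k => r - (k : ℝ)) hfN x
    refine h1.neg_left.congr' ?_ EventuallyEq.rfl
    filter_upwards [self_mem_nhdsWithin] with h (hh : 0 < h)
    rw [leftDeriv_natCast n hf.1.continuous hfi, hop, mul_sub, mul_inv_cancel_left₀ (by positivity)]
    have h2 : ∑ i ∈ Finset.range (n + p),
        h ^ i • (iteratedDeriv i f x * (if i = n then 1 else 0)) = h ^ n * iteratedDeriv n f x := by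
      simp [show 0 < p by omega]
    have h3 : ∀ i ∈ Finset.range (n + p), h ^ i • (iteratedDeriv i f x *
          ((if i = n then 1 else 0) - (∑ k ∈ Finset.range K, w k * (r - k) ^ i) / i.factorial))
        = h ^ i • (iteratedDeriv i f x * (if i = n then 1 else 0)) -
          h ^ i * (iteratedDeriv i f x / i.factorial * ∑ k ∈ Finset.range K, w k * (r - k) ^ i) := by
      intro i _
      simp only [smul_eq_mul]
      ring
    rw [Finset.sum_congr rfl h3, Finset.sum_sub_distrib, h2]
    ring
  have hscale : ∀ (f : ℝ → ℝ) (x : ℝ),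
      ((fun h : ℝ => leftDeriv n f x - leftOp n r w h f x) =O[𝓝[>] 0] fun h : ℝ => h ^ p) ↔
      (fun h : ℝ => h ^ n * (leftDeriv n f x - leftOp n r w h f x)) =O[𝓝[>] 0]
        fun h : ℝ => h ^ (n + p) := by
    intro f x
    constructor
    · intro h
      refine ((isBigO_refl (fun h : ℝ => h ^ n) _).mul h).congr_right fun h => ?_
      rw [pow_add]
    · intro h
      refine ((isBigO_refl (fun h : ℝ => (h ^ n)⁻¹) _).mul h).congr' ?_ ?_
      · filter_upwards [self_mem_nhdsWithin] with h (hh : 0 < h)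
        field_simp
      · filter_upwards [self_mem_nhdsWithin] with h (hh : 0 < h)
        rw [pow_add]
        field_simp
  rw [hR]
  constructor
  · intro hA
    -- All derivatives of this f at 0 equal 1, so a single test function isolates every moment.
    obtain ⟨f, hfs, hfe⟩ := exists_smooth_eventuallyEq_exp
    have h1 := (hscale f 0).1 (hA f (hfs _) 0).2
    have h2 := (h1.sub (hmain f (hfs _) 0)).congr_left fun h => sub_sub_cancel _ _
    intro i hi
    have h3 := eq_zero_of_sum_pow_smul_isBigO _ _ h2 i hi
    rw [hfe.iteratedDeriv_eq i, iteratedDeriv_eq_iterate, Real.iter_deriv_exp, Real.exp_zero,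
      one_mul] at h3
    exact (sub_eq_zero.1 h3).symm
  · intro hB f hf x
    refine ⟨Eventually.of_forall fun h => summable_of_ne_finset_zero (s := Finset.range K)
      fun k hk => by rw [hK k hk, zero_mul], (hscale f x).2 ?_⟩
    refine (hmain f hf x).congr_left fun h => ?_
    rw [Finset.sum_eq_zero, sub_zero]
    intro i hi
    rw [hB i (Finset.mem_range.1 hi)]
    simp

/-! ### Fourier representation of the fractional derivative. -/

-- Both sides are analytic in c on the right half-plane and agree for real c > 0 by the Gamma
-- integral; the identity theorem extends the equality.
open Complex in
theorem integral_rpow_mul_cexp_neg_mul_Ioi {s : ℝ} (hs : 0 < s) {c : ℂ} (hc : 0 < c.re) :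
    ∫ t : ℝ in Set.Ioi 0, ((t ^ (s - 1) : ℝ) : ℂ) * cexp (-(c * t)) =
      (1 / c) ^ (s : ℂ) * Real.Gamma s := by
  have hint : ∀ a : ℝ, -1 < a → ∀ b : ℝ, 0 < b →
      IntegrableOn (fun t : ℝ => t ^ a * Real.exp (-b * t)) (Set.Ioi 0) := by
    intro a ha b hb
    simpa using integrableOn_rpow_mul_exp_neg_mul_rpow ha one_pos hb
  have hmeas : ∀ (a : ℝ) (c : ℂ), AEStronglyMeasurable
      (fun t : ℝ => ((t ^ a : ℝ) : ℂ) * cexp (-(c * t))) (volume.restrict (Set.Ioi 0)) := by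
    intro a c
    exact (by fun_prop : Measurable fun t : ℝ => ((t ^ a : ℝ) : ℂ) * cexp (-(c * t))).aestronglyMeasurable
  have hnorm : ∀ (a : ℝ) (c : ℂ) (t : ℝ), 0 < t →
      ‖((t ^ a : ℝ) : ℂ) * cexp (-(c * t))‖ = t ^ a * Real.exp (-c.re * t) := by
    intro a c t ht
    rw [norm_mul, Complex.norm_exp, Complex.norm_real, Real.norm_eq_abs,
      abs_of_nonneg (Real.rpow_nonneg ht.le _)]
    simp
  have hintc : ∀ (a : ℝ), -1 < a → ∀ c : ℂ, 0 < c.re → IntegrableOn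
      (fun t : ℝ => ((t ^ a : ℝ) : ℂ) * cexp (-(c * t))) (Set.Ioi 0) := by
    intro a ha c hc
    refine (hint a ha c.re hc).mono' (hmeas a c) ?_
    filter_upwards [ae_restrict_mem measurableSet_Ioi] with t ht using (hnorm a c t ht).le
  set U : Set ℂ := {z : ℂ | 0 < z.re} with hU
  have hUo : IsOpen U := isOpen_lt continuous_const Complex.continuous_re
  have hL : AnalyticOnNhd ℂ (fun c : ℂ => ∫ t : ℝ in Set.Ioi 0,
      ((t ^ (s - 1) : ℝ) : ℂ) * cexp (-(c * t))) U := by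
    apply DifferentiableOn.analyticOnNhd _ hUo
    intro c (hc : 0 < c.re)
    apply DifferentiableAt.differentiableWithinAt
    -- On Re z > Re c / 2 the c-derivative of the integrand is dominated by t^s e^(-(Re c / 2)t).
    have h := hasDerivAt_integral_of_dominated_loc_of_deriv_le
      (μ := volume.restrict (Set.Ioi (0 : ℝ))) (x₀ := c) (s := {z : ℂ | c.re / 2 < z.re})
      (F := fun c t => ((t ^ (s - 1) : ℝ) : ℂ) * cexp (-(c * t)))
      (F' := fun c t => ((t ^ (s - 1) : ℝ) : ℂ) * (cexp (-(c * t)) * (-(1 * (t : ℂ)))))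
      (bound := fun t => t ^ s * Real.exp (-(c.re / 2) * t))
      ((isOpen_lt continuous_const Complex.continuous_re).mem_nhds (by
        change c.re / 2 < c.re; linarith))
      (Eventually.of_forall fun c => hmeas _ c) (hintc _ (by linarith) c hc)
      ((by fun_prop : Measurable fun t : ℝ =>
        ((t ^ (s - 1) : ℝ) : ℂ) * (cexp (-(c * t)) * (-(1 * (t : ℂ))))).aestronglyMeasurable)
      ?_ (hint s (by linarith) _ (by linarith)) ?_
    · exact h.2.differentiableAt
    · filter_upwards [ae_restrict_mem measurableSet_Ioi] with t ht z hz
      change 0 < t at ht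
      change c.re / 2 < z.re at hz
      rw [← mul_assoc, norm_mul, hnorm _ _ _ ht, norm_neg, one_mul, Complex.norm_real,
        Real.norm_eq_abs, abs_of_pos ht, mul_right_comm, ← Real.rpow_add_one ht.ne',
        sub_add_cancel]
      gcongr
    · filter_upwards with t z _
      exact ((((hasDerivAt_id z).mul_const (t : ℂ)).neg).cexp).const_mul _
  have hR : AnalyticOnNhd ℂ (fun c : ℂ => (1 / c) ^ (s : ℂ) * (Real.Gamma s : ℂ)) U := by
    apply DifferentiableOn.analyticOnNhd _ hUo
    intro c (hc : 0 < c.re)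
    have hc0 : c ≠ 0 := by rintro rfl; simp at hc
    apply DifferentiableAt.differentiableWithinAt
    apply DifferentiableAt.mul_const
    refine DifferentiableAt.cpow_const ?_ (Or.inl ?_)
    · exact (differentiableAt_const _).div differentiableAt_id hc0
    · rw [one_div, Complex.inv_re]
      exact div_pos hc (Complex.normSq_pos.2 hc0)
  have hUc : IsPreconnected U := (convex_halfSpace_re_gt 0).isPreconnected
  refine hL.eqOn_of_preconnected_of_frequently_eq hR hUc (z₀ := 1) (by simp [hU]) ?_ hc
  have hre : Tendsto (fun x : ℝ => (x : ℂ)) (𝓝[≠] 1) (𝓝[≠] 1) := by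
    apply tendsto_nhdsWithin_of_tendsto_nhds_of_eventually_within
    · exact Tendsto.mono_left (Continuous.tendsto' (by fun_prop) _ _ (by simp)) nhdsWithin_le_nhds
    · filter_upwards [self_mem_nhdsWithin] with x hx
      simpa using hx
  apply hre.frequently
  apply Eventually.frequently
  filter_upwards [nhdsWithin_le_nhds (lt_mem_nhds (zero_lt_one' ℝ))] with x hx
  have := Complex.integral_cpow_mul_exp_neg_mul_Ioi (a := (s : ℂ)) (by simpa using hs) hx
  rw [← Complex.Gamma_ofReal, ← this]
  refine setIntegral_congr_fun measurableSet_Ioi fun t (ht : 0 < t) => ?_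
  rw [Complex.ofReal_cpow ht.le]
  push_cast
  rfl

theorem integrable_comp_abs {ψ : ℝ → ℝ} (h : IntegrableOn ψ (Set.Ioi 0)) :
    Integrable fun x => ψ |x| := by
  have h1 : IntegrableOn (fun x => ψ |x|) (Set.Ioi 0) :=
    h.congr_fun (fun x (hx : 0 < x) => by rw [abs_of_pos hx]) measurableSet_Ioi
  have h2 : IntegrableOn (fun x => ψ |x|) (Set.Iic 0) := by
    rw [← Measure.map_neg_eq_self (volume : Measure ℝ)]
    have m : MeasurableEmbedding fun x : ℝ => -x := (Homeomorph.neg ℝ).measurableEmbedding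
    rw [m.integrableOn_map_iff]
    have : (fun x : ℝ => -x) ⁻¹' Set.Iic 0 = Set.Ici 0 := by ext; simp
    rw [this, integrableOn_Ici_iff_integrableOn_Ioi]
    simpa [Function.comp_def] using h1
  rw [← integrableOn_univ, ← Set.Iic_union_Ioi (a := (0 : ℝ))]
  exact h2.union h1

theorem iteratedDeriv_ofReal_comp {N : ℕ} {f : ℝ → ℝ} (hf : ContDiff ℝ N f) {k : ℕ} (hk : k ≤ N)
    (x : ℝ) : iteratedDeriv k (fun y => (f y : ℂ)) x = ((iteratedDeriv k f x : ℝ) : ℂ) := by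
  have := Complex.ofRealCLM.iteratedFDeriv_comp_left (x := x) hf.contDiffAt
    (by exact_mod_cast hk : (k : WithTop ℕ∞) ≤ N)
  simp only [iteratedDeriv]
  change iteratedFDeriv ℝ k (Complex.ofRealCLM ∘ f) x _ = _
  rw [this]
  rfl

open scoped FourierTransform

/-- The Fourier transform of a real function. -/
noncomputable def hat (f : ℝ → ℝ) : ℝ → ℂ := 𝓕 fun x => (f x : ℂ)

theorem norm_two_pi_I_mul (ω : ℝ) :
    ‖(2 * Real.pi * Complex.I * ω : ℂ)‖ = |2 * Real.pi * ω| := by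
  simp [abs_mul]

theorem pow_mul_norm_hat_le {N : ℕ} {f : ℝ → ℝ} (hf : SmoothL1 N f) {k : ℕ} (hk : k ≤ N) (ω : ℝ) :
    |2 * Real.pi * ω| ^ k * ‖hat f ω‖ ≤ ∫ x, |iteratedDeriv k f x| := by
  have hc : ContDiff ℝ ((N : ℕ∞) : WithTop ℕ∞) fun x => (f x : ℂ) :=
    Complex.ofRealCLM.contDiff.comp hf.1
  have h1 := Real.fourier_iteratedDeriv (f := fun x => (f x : ℂ)) (n := k) hc (fun n hn => by
    have hn' : n ≤ N := by exact_mod_cast hn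
    refine ((hf.2 n hn').ofReal (𝕜 := ℂ)).congr (Eventually.of_forall fun x => ?_)
    exact (iteratedDeriv_ofReal_comp hf.1 hn' x).symm) (by exact_mod_cast hk)
  have h2 := congrArg norm (congrFun h1 ω)
  have h3 : ‖𝓕 (iteratedDeriv k fun x => (f x : ℂ)) ω‖ ≤ ∫ x, |iteratedDeriv k f x| := by
    refine (VectorFourier.norm_fourierIntegral_le_integral_norm _ _ _ _ _).trans (le_of_eq ?_)
    refine integral_congr_ae (Eventually.of_forall fun x => ?_)
    simp only
    rw [iteratedDeriv_ofReal_comp hf.1 hk, Complex.norm_real, Real.norm_eq_abs]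
  rw [h2, norm_smul, norm_pow] at h3
  rwa [norm_two_pi_I_mul] at h3

theorem continuous_hat {f : ℝ → ℝ} (hf : Integrable f) : Continuous (hat f) :=
  VectorFourier.fourierIntegral_continuous Real.continuous_fourierChar (by fun_prop) hf.ofReal

/-- `pow_mul_norm_hat_le` is used with k = 0 near the origin, where a > -1 suffices, and with k = N
at infinity, where the decay |ω|^(a-N) is integrable. -/
theorem integrable_rpow_mul_norm_hat {N : ℕ} {f : ℝ → ℝ} (hf : SmoothL1 N f) {a : ℝ}
    (ha : -1 < a) (haN : a - N < -1) : Integrable fun ω => |2 * Real.pi * ω| ^ a * ‖hat f ω‖ := by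
  set C := ∫ x, |iteratedDeriv 0 f x|
  set C' := ∫ x, |iteratedDeriv N f x|
  have hfi : Integrable f := by simpa using hf.2 0 (Nat.zero_le _)
  have hψ : IntegrableOn (fun t : ℝ => if t ≤ 1 then C * t ^ a else C' * t ^ (a - N)) (Set.Ioi 0) := by
    rw [← Set.Ioc_union_Ioi_eq_Ioi (zero_le_one' ℝ)]
    apply IntegrableOn.union
    · have h1 := (intervalIntegral.intervalIntegrable_rpow' (a := 0) (b := 1) ha).const_mul C
      rw [intervalIntegrable_iff_integrableOn_Ioc_of_le zero_le_one] at h1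
      exact h1.congr_fun (fun t ht => by simp [ht.2]) measurableSet_Ioc
    · have h1 := (integrableOn_Ioi_rpow_of_lt haN one_pos).const_mul C'
      exact IntegrableOn.congr_fun h1 (fun t (ht : 1 < t) => by simp [not_le.2 ht]) measurableSet_Ioi
  have h2 := (integrable_comp_abs hψ).comp_mul_left' (by positivity : 2 * Real.pi ≠ 0)
  refine h2.mono' ?_ ?_
  · refine Measurable.aestronglyMeasurable ?_
    have := (continuous_hat hfi).measurable
    fun_prop
  · have h0 : ∀ᵐ ω : ℝ, ω ≠ 0 := by simp [ae_iff, measure_singleton]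
    filter_upwards [h0] with ω hω
    set t := |2 * Real.pi * ω| with ht
    have ht0 : 0 < t := abs_pos.2 (mul_ne_zero (by positivity) hω)
    rw [norm_mul, norm_norm, Real.norm_eq_abs, abs_of_nonneg (by positivity)]
    split_ifs with h1
    · have := pow_mul_norm_hat_le hf (Nat.zero_le N) ω
      rw [pow_zero, one_mul] at this
      rw [mul_comm]
      gcongr
    · have := pow_mul_norm_hat_le hf le_rfl ω
      rw [Real.rpow_sub ht0, Real.rpow_natCast, ← mul_div_assoc, le_div_iff₀ (by positivity)]
      calc t ^ a * ‖hat f ω‖ * t ^ N = t ^ a * (t ^ N * ‖hat f ω‖) := by ring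
        _ ≤ t ^ a * C' := by gcongr
        _ = C' * t ^ a := mul_comm _ _

theorem integrable_hat {N : ℕ} {f : ℝ → ℝ} (hf : SmoothL1 N f) (hN : 2 ≤ N) :
    Integrable (hat f) := by
  have hfi : Integrable f := by simpa using hf.2 0 (Nat.zero_le _)
  have hN' : (2 : ℝ) ≤ N := by exact_mod_cast hN
  have := integrable_rpow_mul_norm_hat hf (a := 0) (by norm_num) (by linarith)
  rw [← integrable_norm_iff (continuous_hat hfi).aestronglyMeasurable]
  simpa using this

/-- The function `ω ↦ (2πiω)^a f̂(ω)`. -/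
noncomputable def hatPow (a : ℝ) (f : ℝ → ℝ) (ω : ℝ) : ℂ :=
  (2 * Real.pi * Complex.I * ω : ℂ) ^ (a : ℂ) * hat f ω

theorem norm_hatPow (a : ℝ) (f : ℝ → ℝ) (ω : ℝ) :
    ‖hatPow a f ω‖ = |2 * Real.pi * ω| ^ a * ‖hat f ω‖ := by
  rw [hatPow, norm_mul, Complex.norm_cpow_real, norm_two_pi_I_mul]

theorem measurable_hatPow (a : ℝ) {f : ℝ → ℝ} (hf : Integrable f) : Measurable (hatPow a f) := by
  have := (continuous_hat hf).measurable
  unfold hatPow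
  fun_prop

theorem integrable_hatPow {N : ℕ} {f : ℝ → ℝ} (hf : SmoothL1 N f) {a : ℝ}
    (ha : -1 < a) (haN : a - N < -1) : Integrable (hatPow a f) := by
  have hfi : Integrable f := by simpa using hf.2 0 (Nat.zero_le _)
  rw [← integrable_norm_iff (measurable_hatPow a hfi).aestronglyMeasurable]
  simpa only [norm_hatPow] using integrable_rpow_mul_norm_hat hf ha haN

theorem fourierInv_hat {N : ℕ} {f : ℝ → ℝ} (hf : SmoothL1 N f) (hN : 2 ≤ N) (x : ℝ) :
    𝓕⁻ (hat f) x = (f x : ℂ) := by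
  have hfi : Integrable f := by simpa using hf.2 0 (Nat.zero_le _)
  have hc : Continuous fun x => (f x : ℂ) := Complex.continuous_ofReal.comp hf.1.continuous
  exact congrFun (hc.fourierInv_fourier_eq hfi.ofReal (integrable_hat hf hN)) x

theorem fourierInv_eq_integral (g : ℝ → ℂ) (x : ℝ) :
    𝓕⁻ g x = ∫ ω : ℝ, Complex.exp (2 * Real.pi * Complex.I * ω * x) * g ω := by
  rw [Real.fourierInv_eq']
  refine integral_congr_ae (Eventually.of_forall fun ω => ?_)
  simp only [smul_eq_mul, RCLike.inner_apply, conj_trivial]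
  push_cast
  ring_nf

theorem norm_exp_two_pi_I (ω x : ℝ) : ‖Complex.exp (2 * Real.pi * Complex.I * ω * x)‖ = 1 := by
  have : (2 * Real.pi * Complex.I * ω * x : ℂ) = ((2 * Real.pi * ω * x : ℝ) : ℂ) * Complex.I := by
    push_cast; ring
  rw [this, Complex.norm_exp_ofReal_mul_I]

theorem abs_le_integral_hat {N : ℕ} {f : ℝ → ℝ} (hf : SmoothL1 N f) (hN : 2 ≤ N) (x : ℝ) :
    |f x| ≤ ∫ ω, ‖hat f ω‖ := by
  rw [← Real.norm_eq_abs, ← Complex.norm_real, ← fourierInv_hat hf hN, fourierInv_eq_integral]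
  refine (norm_integral_le_integral_norm _).trans (le_of_eq ?_)
  simp only [norm_mul, norm_exp_two_pi_I, one_mul]

theorem integral_Iio_div_rpow (f : ℝ → ℝ) (s y : ℝ) :
    ∫ η in Set.Iio y, f η / (y - η) ^ (1 - s) = ∫ t in Set.Ioi 0, t ^ (s - 1) * f (y - t) := by
  have h := (volume.measurePreserving_sub_left y).setIntegral_preimage_emb
    (Homeomorph.subLeft y).measurableEmbedding (fun η => f η / (y - η) ^ (1 - s)) (Set.Iio y)
  rw [← h]
  have : (fun t => y - t) ⁻¹' Set.Iio y = Set.Ioi 0 := by ext; simp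
  rw [this]
  refine setIntegral_congr_fun measurableSet_Ioi fun t (ht : 0 < t) => ?_
  simp only [sub_sub_cancel]
  rw [show s - 1 = -(1 - s) by ring, Real.rpow_neg ht.le]
  ring

theorem two_pi_I_mul_mem_slitPlane {ω : ℝ} (hω : ω ≠ 0) :
    (2 * Real.pi * Complex.I * ω : ℂ) ∈ Complex.slitPlane := by
  right
  simp [hω, Real.pi_ne_zero]

theorem integrableOn_rpow_mul_exp_neg {s ε : ℝ} (hs : 0 < s) (hε : 0 < ε) :
    IntegrableOn (fun t : ℝ => t ^ (s - 1) * Real.exp (-ε * t)) (Set.Ioi 0) := by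
  simpa using integrableOn_rpow_mul_exp_neg_mul_rpow (by linarith : -1 < s - 1) one_pos hε

/-- The kernel t^(s-1) is not integrable at infinity. The factor e^(-εt) makes the double integral
absolutely convergent, so Fubini applies, and the inner integral is the Gamma integral with c = ε +
2πiω. -/
theorem integral_regularized {N : ℕ} {f : ℝ → ℝ} (hf : SmoothL1 N f) (hN : 2 ≤ N) {s : ℝ}
    (hs : 0 < s) {ε : ℝ} (hε : 0 < ε) (y : ℝ) :
    ∫ t : ℝ in Set.Ioi 0, ((t ^ (s - 1) * Real.exp (-ε * t) * f (y - t) : ℝ) : ℂ) =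
      Real.Gamma s * ∫ ω : ℝ, Complex.exp (2 * Real.pi * Complex.I * ω * y) *
        ((1 / (ε + 2 * Real.pi * Complex.I * ω)) ^ (s : ℂ) * hat f ω) := by
  have hfi : Integrable f := by simpa using hf.2 0 (Nat.zero_le _)
  have hmh := (continuous_hat hfi).measurable
  have h1 : ∀ t : ℝ, ((t ^ (s - 1) * Real.exp (-ε * t) * f (y - t) : ℝ) : ℂ) =
      ∫ ω : ℝ, ((t ^ (s - 1) * Real.exp (-ε * t) : ℝ) : ℂ) *
        (Complex.exp (2 * Real.pi * Complex.I * ω * (y - t : ℝ)) * hat f ω) := by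
    intro t
    rw [integral_const_mul, ← fourierInv_eq_integral, fourierInv_hat hf hN]
    push_cast
    rfl
  have hprod : Integrable (Function.uncurry fun (t ω : ℝ) =>
      ((t ^ (s - 1) * Real.exp (-ε * t) : ℝ) : ℂ) *
        (Complex.exp (2 * Real.pi * Complex.I * ω * (y - t : ℝ)) * hat f ω))
      ((volume.restrict (Set.Ioi 0)).prod volume) := by
    have h2 := ((integrableOn_rpow_mul_exp_neg hs hε).ofReal (𝕜 := ℂ)).mul_prod
      (integrable_hat hf hN)
    refine h2.norm.mono' ?_ (Eventually.of_forall fun z => le_of_eq ?_)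
    · refine Measurable.aestronglyMeasurable ?_
      unfold Function.uncurry
      fun_prop
    · simp only [Function.uncurry, norm_mul]
      rw [norm_exp_two_pi_I, one_mul]
      rfl
  simp only [h1]
  rw [integral_integral_swap hprod, ← integral_const_mul]
  refine integral_congr_ae (Eventually.of_forall fun ω => ?_)
  have h3 := integral_rpow_mul_cexp_neg_mul_Ioi hs
    (c := (ε + 2 * Real.pi * Complex.I * ω : ℂ)) (by simpa using hε)
  simp only
  rw [show ∀ a b c d : ℂ, a * (b * (c * d)) = b * d * (c * a) by intros; ring, ← h3,
    ← integral_const_mul]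
  refine setIntegral_congr_fun measurableSet_Ioi fun t _ => ?_
  have h4 : Complex.exp (2 * Real.pi * Complex.I * ω * (y - t : ℝ)) * Complex.exp (-(ε * t)) =
      Complex.exp (2 * Real.pi * Complex.I * ω * y) *
        Complex.exp (-((ε + 2 * Real.pi * Complex.I * ω) * t)) := by
    rw [← Complex.exp_add, ← Complex.exp_add]
    congr 1
    push_cast
    ring
  push_cast at h4 ⊢
  rw [neg_mul]
  linear_combination ((t ^ (s - 1) : ℝ) : ℂ) * hat f ω * h4

/-- The limit ε → 0+ of `integral_regularized`, by dominated convergence on both sides. -/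
theorem integral_Iio_eq_fourierInv {N : ℕ} {f : ℝ → ℝ} (hf : SmoothL1 N f) (hN : 2 ≤ N) {s : ℝ}
    (hs : 0 < s) (hs1 : s < 1) (y : ℝ) :
    ((∫ η in Set.Iio y, f η / (y - η) ^ (1 - s) : ℝ) : ℂ) =
      Real.Gamma s * 𝓕⁻ (hatPow (-s) f) y := by
  have hN' : (2 : ℝ) ≤ N := by exact_mod_cast hN
  have hfi : Integrable f := by simpa using hf.2 0 (Nat.zero_le _)
  have hmh := (continuous_hat hfi).measurable
  have hmf := hf.1.continuous.measurable
  have hleft : Tendsto (fun ε : ℝ =>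
      ∫ t : ℝ in Set.Ioi 0, ((t ^ (s - 1) * Real.exp (-ε * t) * f (y - t) : ℝ) : ℂ)) (𝓝[>] 0)
      (𝓝 (∫ t : ℝ in Set.Ioi 0, ((t ^ (s - 1) * f (y - t) : ℝ) : ℂ))) := by
    -- Near 0 boundedness of f is used; beyond 1, t^(s-1) ≤ 1 and f is integrable.
    have hbound : IntegrableOn (fun t : ℝ => t ^ (s - 1) * |f (y - t)|) (Set.Ioi 0) := by
      rw [← Set.Ioc_union_Ioi_eq_Ioi (zero_le_one' ℝ)]
      apply IntegrableOn.union
      · have h1 := (intervalIntegral.intervalIntegrable_rpow' (a := 0) (b := 1)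
          (by linarith : -1 < s - 1)).mul_const (∫ ω, ‖hat f ω‖)
        rw [intervalIntegrable_iff_integrableOn_Ioc_of_le zero_le_one] at h1
        refine h1.mono' (by fun_prop) ?_
        filter_upwards [ae_restrict_mem measurableSet_Ioc] with t ht
        have := Real.rpow_nonneg ht.1.le (s - 1)
        rw [Real.norm_eq_abs, abs_of_nonneg (by positivity)]
        gcongr
        exact abs_le_integral_hat hf hN _
      · have h1 : Integrable fun t => |f (y - t)| := (hfi.comp_sub_left y).abs
        refine h1.integrableOn.mono' (by fun_prop) ?_
        filter_upwards [ae_restrict_mem measurableSet_Ioi] with t (ht : 1 < t)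
        have ht0 : 0 ≤ t := by linarith
        rw [Real.norm_eq_abs, abs_of_nonneg (by positivity)]
        exact mul_le_of_le_one_left (abs_nonneg _)
          (Real.rpow_le_one_of_one_le_of_nonpos ht.le (by linarith))
    refine tendsto_integral_filter_of_dominated_convergence _
      (Eventually.of_forall fun ε => by fun_prop) ?_ hbound ?_
    · filter_upwards [self_mem_nhdsWithin] with ε (hε : 0 < ε)
      filter_upwards [ae_restrict_mem measurableSet_Ioi] with t (ht : 0 < t)
      rw [Complex.norm_real, Real.norm_eq_abs, abs_mul, abs_mul, Real.abs_exp,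
        abs_of_nonneg (Real.rpow_nonneg ht.le _)]
      gcongr
      apply mul_le_of_le_one_right (Real.rpow_nonneg ht.le _)
      rw [Real.exp_le_one_iff]
      nlinarith
    · filter_upwards with t
      apply Tendsto.mono_left _ nhdsWithin_le_nhds
      exact Continuous.tendsto' (by fun_prop) _ _ (by simp)
  have hright : Tendsto (fun ε : ℝ => Real.Gamma s * ∫ ω : ℝ,
      Complex.exp (2 * Real.pi * Complex.I * ω * y) *
        ((1 / (ε + 2 * Real.pi * Complex.I * ω)) ^ (s : ℂ) * hat f ω)) (𝓝[>] 0)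
      (𝓝 (Real.Gamma s * ∫ ω : ℝ, Complex.exp (2 * Real.pi * Complex.I * ω * y) *
        hatPow (-s) f ω)) := by
    apply Tendsto.const_mul
    have h0 : ∀ᵐ ω : ℝ, ω ≠ 0 := by simp [ae_iff, measure_singleton]
    refine tendsto_integral_filter_of_dominated_convergence _
      (Eventually.of_forall fun ε => by fun_prop) ?_
      (integrable_rpow_mul_norm_hat hf (a := -s) (by linarith) (by linarith)) ?_
    · filter_upwards [self_mem_nhdsWithin] with ε (hε : 0 < ε)
      filter_upwards [h0] with ω hω
      rw [norm_mul, norm_exp_two_pi_I, one_mul, norm_mul, Complex.norm_cpow_real, norm_div,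
        norm_one, one_div, Real.inv_rpow (norm_nonneg _), ← Real.rpow_neg (norm_nonneg _)]
      have h1 : 0 < |2 * Real.pi * ω| := abs_pos.2 (mul_ne_zero (by positivity) hω)
      have h2 : |2 * Real.pi * ω| ≤ ‖(ε + 2 * Real.pi * Complex.I * ω : ℂ)‖ := by
        convert Complex.abs_im_le_norm _ using 2
        simp
      -- |ε + 2πiω| ≥ |2πω| and the exponent -s is negative; s < 1 keeps the bound integrable at the
      -- origin.
      exact mul_le_mul_of_nonneg_right (Real.rpow_le_rpow_of_nonpos h1 h2 (by linarith))
        (norm_nonneg _)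
    · filter_upwards [h0] with ω hω
      apply Tendsto.const_mul
      apply Tendsto.mul_const
      have hz := two_pi_I_mul_mem_slitPlane hω
      have hz0 : (2 * Real.pi * Complex.I * ω : ℂ) ≠ 0 := Complex.slitPlane_ne_zero hz
      have hlim : Tendsto (fun ε : ℝ => 1 / (ε + 2 * Real.pi * Complex.I * ω : ℂ)) (𝓝[>] 0)
          (𝓝 (1 / (2 * Real.pi * Complex.I * ω))) := by
        apply Tendsto.mono_left _ nhdsWithin_le_nhds
        refine Tendsto.div tendsto_const_nhds (Continuous.tendsto' (by fun_prop) _ _ (by simp)) hz0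
      have hsl : 1 / (2 * Real.pi * Complex.I * ω : ℂ) ∈ Complex.slitPlane := by
        rw [one_div]
        right
        simp [hω, Real.pi_ne_zero]
      have hpow := (continuousAt_cpow_const (b := (s : ℂ)) hsl).tendsto.comp hlim
      rw [one_div, Complex.inv_cpow _ _ (Complex.slitPlane_arg_ne_pi hz), ← Complex.cpow_neg,
        ← Complex.ofReal_neg] at hpow
      exact hpow
  rw [integral_Iio_div_rpow, fourierInv_eq_integral, ← integral_complex_ofReal]
  refine tendsto_nhds_unique hleft (hright.congr' ?_)
  filter_upwards [self_mem_nhdsWithin] with ε hε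
  exact (integral_regularized hf hN hs hε y).symm

/-- The left Riemann-Liouville derivative is the Fourier multiplier `(2πiω)^α`. -/
theorem leftDeriv_eq_fourierInv {N n : ℕ} {α : ℝ} (hn₁ : (n : ℝ) - 1 < α) (hn₂ : α < n)
    (hα : 0 < α) (hN : n + 2 ≤ N) {f : ℝ → ℝ} (hf : SmoothL1 N f) (x : ℝ) :
    (leftDeriv α f x : ℂ) = 𝓕⁻ (hatPow α f) x := by
  have hN' : (n : ℝ) + 2 ≤ N := by exact_mod_cast hN
  have hfi : Integrable f := by simpa using hf.2 0 (Nat.zero_le _)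
  have hn : 1 ≤ n := by
    rcases Nat.eq_zero_or_pos n with rfl | h
    · simp at hn₂; linarith
    · exact h
  have hfl : ⌊α⌋₊ + 1 = n := by
    have : ⌊α⌋₊ = n - 1 := by
      rw [Nat.floor_eq_iff hα.le]
      push_cast [hn]
      exact ⟨hn₁.le, by linarith⟩
    omega
  set s : ℝ := n - α with hs
  have hs0 : 0 < s := by linarith
  have hs1 : s < 1 := by linarith
  have hΓ : Real.Gamma s ≠ 0 := (Real.Gamma_pos_of_pos hs0).ne'
  set g : ℝ → ℂ := hatPow (-s) f with hg
  have h0 : ∀ᵐ ω : ℝ, ω ≠ 0 := by simp [ae_iff, measure_singleton]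
  -- These moments allow n differentiations under the Fourier integral: k - s > -1 since s < 1, and
  -- k - s - N < -1 since N ≥ n + 2.
  have hgint : ∀ k : ℕ, k ≤ n → Integrable fun ω : ℝ => (ω : ℝ) ^ k • g ω := by
    intro k hk
    have hk' : (k : ℝ) ≤ n := by exact_mod_cast hk
    have hk0 : (0 : ℝ) ≤ k := k.cast_nonneg
    have h1 := (integrable_rpow_mul_norm_hat hf (a := k - s) (by linarith) (by linarith)).const_mul
      ((2 * Real.pi) ^ k)⁻¹
    refine h1.mono' ((by fun_prop : Measurable fun ω : ℝ => ω ^ k).aestronglyMeasurable.smul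
      (measurable_hatPow _ hfi).aestronglyMeasurable) ?_
    filter_upwards [h0] with ω hω
    have h2 : 0 < |2 * Real.pi * ω| := abs_pos.2 (mul_ne_zero (by positivity) hω)
    have h3 : (2 * Real.pi) ^ k * |ω| ^ k = |2 * Real.pi * ω| ^ k := by
      rw [← mul_pow, abs_mul, abs_of_pos Real.two_pi_pos]
    rw [norm_smul, hg, norm_hatPow, norm_pow, Real.norm_eq_abs, sub_eq_add_neg, Real.rpow_add h2,
      Real.rpow_natCast, ← h3]
    have : (2 * Real.pi) ^ k ≠ 0 := by positivity
    field_simp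
    exact le_rfl
  have hgneg : ∀ k : ℕ, k ≤ n → Integrable fun ω : ℝ => (ω : ℝ) ^ k • g (-ω) := by
    intro k hk
    refine (((hgint k hk).comp_neg).smul ((-1 : ℝ) ^ k)).congr (Eventually.of_forall fun ω => ?_)
    simp only [Pi.smul_apply, smul_smul, ← mul_pow]
    simp
  have hinv : 𝓕⁻ g = 𝓕 fun ω => g (-ω) := Real.fourierInv_eq_fourier_comp_neg g
  have hcd : ContDiff ℝ ((n : ℕ∞) : WithTop ℕ∞) (𝓕⁻ g) := by
    rw [hinv]
    refine Real.contDiff_fourier fun k hk => ?_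
    refine (hgneg k (by exact_mod_cast hk)).norm.congr (Eventually.of_forall fun ω => ?_)
    simp
  set F : ℝ → ℝ := fun y => ∫ η in Set.Iio y, f η / (y - η) ^ (1 - s) with hF
  have hFc : ∀ y, (F y : ℂ) = Real.Gamma s * 𝓕⁻ g y := fun y =>
    integral_Iio_eq_fourierInv hf (by omega) hs0 hs1 y
  have hFd : ContDiff ℝ n F := by
    have : F = fun y => (Complex.reCLM ((Real.Gamma s : ℂ) * 𝓕⁻ g y)) := by
      funext y
      rw [← hFc]
      simp
    rw [this]
    exact Complex.reCLM.contDiff.comp (contDiff_const.mul hcd)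
  have hexp : α + 1 - (n : ℝ) = 1 - s := by rw [hs]; ring
  rw [leftDeriv]
  simp only [hfl, hexp]
  rw [← hs, ← hF, Complex.ofReal_mul, ← iteratedDeriv_ofReal_comp hFd le_rfl x]
  simp only [hFc]
  rw [iteratedDeriv_const_mul_field, hinv, Real.iteratedDeriv_fourier (N := n) (n := n)
    (fun k hk => hgneg k (by exact_mod_cast hk)) le_rfl, ← mul_assoc]
  have : ((1 / Real.Gamma s : ℝ) : ℂ) * (Real.Gamma s : ℂ) = 1 := by
    rw [← Complex.ofReal_mul, one_div, inv_mul_cancel₀ hΓ, Complex.ofReal_one]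
  rw [this, one_mul, Real.fourierInv_eq_fourier_comp_neg]
  refine Real.fourier_congr_ae ?_ x
  filter_upwards [h0] with ω hω
  have hne : (2 * Real.pi * Complex.I * ((-ω : ℝ) : ℂ)) ≠ 0 :=
    Complex.slitPlane_ne_zero (two_pi_I_mul_mem_slitPlane (neg_ne_zero.2 hω))
  simp only [hg, hatPow, smul_eq_mul]
  rw [← mul_assoc]
  congr 1
  -- Writing the inverse transform as a forward one reflects ω. The n derivatives contribute the
  -- n-th power, and n - s = α.
  rw [show (-2 * Real.pi * Complex.I * ω : ℂ) = 2 * Real.pi * Complex.I * ((-ω : ℝ) : ℂ) by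
    push_cast; ring, ← Complex.cpow_natCast, ← Complex.cpow_add _ _ hne]
  congr 1
  rw [hs]
  push_cast
  ring

/-! ### The complex symbol and the Grünwald operator as a multiplier. -/

/-- The symbol `W(e^(-z)) e^(rz)` on the closed right half-plane. -/
noncomputable def symbol (r : ℝ) (w : ℕ → ℝ) (z : ℂ) : ℂ :=
  (∑' k : ℕ, (w k : ℂ) * Complex.exp (-z) ^ k) * Complex.exp ((r : ℂ) * z)

theorem symbol_ofReal (r : ℝ) (w : ℕ → ℝ) (x : ℝ) : symbol r w x = (realSymbol r w x : ℂ) := by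
  rw [symbol, realSymbol]
  push_cast
  rfl

theorem norm_exp_neg_le_one {z : ℂ} (hz : 0 ≤ z.re) : ‖Complex.exp (-z)‖ ≤ 1 := by
  rw [Complex.norm_exp]
  simpa using hz

theorem norm_weight_mul_exp_pow_le (w : ℕ → ℝ) {z : ℂ} (hz : 0 ≤ z.re) (k : ℕ) :
    ‖(w k : ℂ) * Complex.exp (-z) ^ k‖ ≤ |w k| := by
  rw [norm_mul, norm_pow, Complex.norm_real, Real.norm_eq_abs]
  exact mul_le_of_le_one_right (abs_nonneg _) (pow_le_one₀ (norm_nonneg _) (norm_exp_neg_le_one hz))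

theorem continuousOn_symbol {r : ℝ} {w : ℕ → ℝ} (hsum : Summable fun k => |w k|) :
    ContinuousOn (symbol r w) {z : ℂ | 0 ≤ z.re} := by
  refine ContinuousOn.mul (continuousOn_tsum (fun k => by fun_prop) hsum fun k z hz =>
    norm_weight_mul_exp_pow_le w hz k) (by fun_prop)

theorem norm_symbol_I_mul_le {r : ℝ} {w : ℕ → ℝ} (hsum : Summable fun k => |w k|) (y : ℝ) :
    ‖symbol r w (Complex.I * y)‖ ≤ ∑' k, |w k| := by
  have h1 : ‖Complex.exp ((r : ℂ) * (Complex.I * y))‖ = 1 := by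
    rw [show (r : ℂ) * (Complex.I * y) = ((r * y : ℝ) : ℂ) * Complex.I by push_cast; ring,
      Complex.norm_exp_ofReal_mul_I]
  rw [symbol, norm_mul, h1, mul_one]
  exact tsum_of_norm_bounded hsum.hasSum fun k => norm_weight_mul_exp_pow_le w (by simp) k

/-- Each translate of f becomes an exponential factor; ∑ |w_k| < ∞ and integrability of the
transform permit summation under the integral. -/
theorem ofReal_leftOp_eq_fourierInv {N : ℕ} {f : ℝ → ℝ} (hf : SmoothL1 N f) (hN : 2 ≤ N)
    (α r : ℝ) {w : ℕ → ℝ} (hsum : Summable fun k => |w k|) (h x : ℝ) :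
    (leftOp α r w h f x : ℂ) = 𝓕⁻ (fun ω => ((h ^ α : ℝ) : ℂ)⁻¹ *
      symbol r w (Complex.I * (2 * Real.pi * ω * h : ℝ)) * hat f ω) x := by
  have hfi : Integrable f := by simpa using hf.2 0 (Nat.zero_le _)
  have hmh := (continuous_hat hfi).measurable
  have hih := integrable_hat hf hN
  set F : ℕ → ℝ → ℂ := fun k ω => (w k : ℂ) *
    (Complex.exp (2 * Real.pi * Complex.I * ω * (x - ((k : ℝ) - r) * h : ℝ)) * hat f ω) with hF
  have hFn : ∀ k ω, ‖F k ω‖ = |w k| * ‖hat f ω‖ := by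
    intro k ω
    rw [hF]
    simp only [norm_mul, Complex.norm_real, Real.norm_eq_abs]
    rw [norm_exp_two_pi_I, one_mul]
  have hFi : ∀ k, Integrable (F k) := by
    intro k
    refine (hih.norm.const_mul |w k|).mono' ?_ (Eventually.of_forall fun ω => (hFn k ω).le)
    refine Measurable.aestronglyMeasurable ?_
    fun_prop
  have hFint : ∀ k, ∫ ω, F k ω = ((w k * f (x - ((k : ℝ) - r) * h) : ℝ) : ℂ) := by
    intro k
    rw [hF]
    simp only
    rw [integral_const_mul, ← fourierInv_eq_integral, fourierInv_hat hf hN]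
    push_cast
    rfl
  have hs := hasSum_integral_of_summable_integral_norm hFi (by
    simp only [hFn, integral_const_mul]
    exact hsum.mul_right _)
  have hts := hs.tsum_eq
  simp only [hFint] at hts
  rw [leftOp, Complex.ofReal_mul, Complex.ofReal_tsum, hts, fourierInv_eq_integral,
    ← integral_const_mul]
  refine integral_congr_ae (Eventually.of_forall fun ω => ?_)
  set z : ℂ := Complex.I * (2 * Real.pi * ω * h : ℝ) with hz
  have h1 : ∀ k, F k ω = (w k : ℂ) * Complex.exp (-z) ^ k *
      (Complex.exp (r * z) * Complex.exp (2 * Real.pi * Complex.I * ω * x) * hat f ω) := by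
    intro k
    have : Complex.exp (2 * Real.pi * Complex.I * ω * (x - ((k : ℝ) - r) * h : ℝ)) =
        Complex.exp (-z) ^ k * Complex.exp (r * z) *
          Complex.exp (2 * Real.pi * Complex.I * ω * x) := by
      rw [← Complex.exp_nat_mul, ← Complex.exp_add, ← Complex.exp_add, hz]
      congr 1
      push_cast
      ring
    rw [hF]
    simp only
    rw [this]
    ring
  simp only [h1, tsum_mul_right]
  rw [← hz, symbol, one_div, Complex.ofReal_inv]
  ring

theorem pow_le_of_le {δ y : ℝ} (hδ : 0 < δ) (hδ1 : δ ≤ 1) (hy : δ ≤ y) {k p : ℕ} (hk : k ≤ p) :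
    y ^ k ≤ y ^ p / δ ^ p := by
  have h1 : 1 ≤ y / δ := (one_le_div hδ).2 hy
  have h2 : (y / δ) ^ k ≤ (y / δ) ^ p := pow_le_pow_right₀ h1 hk
  rw [div_pow, div_pow] at h2
  refine le_trans ?_ h2
  rw [le_div_iff₀ (by positivity)]
  exact mul_le_of_le_one_right (pow_nonneg (hδ.le.trans hy) _) (pow_le_one₀ hδ.le hδ1)

/-- The g_k are the Taylor coefficients of G at 0. The same g_k serve on the imaginary axis, where
the bound must be global for the Fourier integral, and on the positive reals, where it is only
needed near 0. -/
theorem exists_symbol_expansion {α r : ℝ} (hα : 0 < α) {w : ℕ → ℝ}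
    (hsum : Summable fun k => |w k|) (hG : HasAnalyticSymbol α r w) (p : ℕ) :
    ∃ g : ℕ → ℂ,
      (∃ C : ℝ, ∀ y : ℝ, y ≠ 0 → ‖symbol r w (Complex.I * y) - (Complex.I * y) ^ (α : ℂ) *
        ∑ k ∈ Finset.range p, (Complex.I * y) ^ k * g k‖ ≤ C * |y| ^ (α + p)) ∧
      (fun x : ℝ => symbol r w x - (x : ℂ) ^ (α : ℂ) * ∑ k ∈ Finset.range p, (x : ℂ) ^ k * g k)
        =O[𝓝[>] 0] fun x : ℝ => x ^ (α + p) := by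
  obtain ⟨R, hR, G, hGa, hGeq⟩ := hG
  obtain ⟨P, hP⟩ := hGa 0 (by simp; linarith)
  obtain ⟨C₁, hC₁, hO⟩ := (hP.isBigO_sub_partialSum_pow p).exists_pos
  rw [IsBigOWith, Metric.eventually_nhds_iff] at hO
  obtain ⟨δ₀, hδ₀, hO⟩ := hO
  set g : ℕ → ℂ := P.coeff with hg
  -- δ ≤ 1 ≤ R keeps the small disc inside the domain of G.
  set δ := min δ₀ 1 with hδd
  have hδ : 0 < δ := lt_min hδ₀ one_pos
  have hδ1 : δ ≤ 1 := min_le_right _ _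
  set T : ℂ → ℂ := fun z => ∑ k ∈ Finset.range p, z ^ k * g k with hT
  have hGT : ∀ z : ℂ, ‖z‖ < δ → ‖G z - T z‖ ≤ C₁ * ‖z‖ ^ p := by
    intro z hz
    have h1 := hO (y := z) (by simpa using hz.trans_le (min_le_left _ _))
    simpa [FormalMultilinearSeries.partialSum, hT, hg] using h1
  have hopen : ∀ z : ℂ, 0 < z.re → ‖z‖ < δ → symbol r w z = z ^ (α : ℂ) * G z := by
    intro z hz hzδ
    have hz0 : z ≠ 0 := by rintro rfl; simp at hz
    have hza : z ^ (α : ℂ) ≠ 0 := by simp [Complex.cpow_eq_zero_iff, hz0]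
    rw [hGeq z hz ((hzδ.le.trans hδ1).trans hR), symbol]
    field_simp
  -- The defining formula of G holds for Re z > 0 only; it reaches the imaginary axis as the limit
  -- of z + ε, all factors being continuous there off 0.
  have hclosed : ∀ z : ℂ, 0 ≤ z.re → z ≠ 0 → ‖z‖ < δ → symbol r w z = z ^ (α : ℂ) * G z := by
    intro z hz hz0 hzδ
    have hsl : z ∈ Complex.slitPlane := by
      rcases hz.lt_or_eq with h | h
      · exact Or.inl h
      · refine Or.inr fun him => hz0 (Complex.ext h.symm him)
    have hl : Tendsto (fun ε : ℝ => z + ε) (𝓝[>] 0) (𝓝 z) :=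
      Tendsto.mono_left (Continuous.tendsto' (by fun_prop) _ _ (by simp)) nhdsWithin_le_nhds
    have hl' : Tendsto (fun ε : ℝ => z + ε) (𝓝[>] 0) (𝓝[{z : ℂ | 0 ≤ z.re}] z) := by
      apply tendsto_nhdsWithin_of_tendsto_nhds_of_eventually_within _ hl
      filter_upwards [self_mem_nhdsWithin] with ε (hε : 0 < ε)
      simp only [Complex.add_re, Complex.ofReal_re]
      positivity
    have hS := (continuousOn_symbol (r := r) hsum z hz).tendsto.comp hl'
    have hGz : ContinuousAt G z :=
      (hGa z (by simpa using (hzδ.le.trans hδ1).trans hR)).continuousAt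
    have hR := ((continuousAt_cpow_const (b := (α : ℂ)) hsl).mul hGz).tendsto.comp hl
    refine tendsto_nhds_unique hS (hR.congr' ?_)
    have hn : ∀ᶠ ε : ℝ in 𝓝[>] 0, ‖z + ε‖ < δ := hl.norm.eventually (gt_mem_nhds hzδ)
    filter_upwards [self_mem_nhdsWithin, hn] with ε (hε : 0 < ε) hεδ
    exact (hopen _ (by simp only [Complex.add_re, Complex.ofReal_re]; positivity) hεδ).symm
  have hnear : ∀ z : ℂ, 0 ≤ z.re → z ≠ 0 → ‖z‖ < δ →
      ‖symbol r w z - z ^ (α : ℂ) * T z‖ ≤ C₁ * ‖z‖ ^ (α + p) := by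
    intro z hz hz0 hzδ
    rw [hclosed z hz hz0 hzδ, ← mul_sub, norm_mul, Complex.norm_cpow_real,
      Real.rpow_add (norm_pos_iff.2 hz0), Real.rpow_natCast]
    calc ‖z‖ ^ α * ‖G z - T z‖ ≤ ‖z‖ ^ α * (C₁ * ‖z‖ ^ p) := by gcongr; exact hGT z hzδ
      _ = C₁ * (‖z‖ ^ α * ‖z‖ ^ p) := by ring
  -- The first term handles |y| < δ. For |y| ≥ δ the other two bound the symbol and the Taylor
  -- polynomial separately.
  refine ⟨g, ⟨C₁ + (∑' k, |w k|) / δ ^ (α + p) + (∑ k ∈ Finset.range p, ‖g k‖) / δ ^ p,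
    fun y hy => ?_⟩, ?_⟩
  · have hA : 0 ≤ ∑' k, |w k| := tsum_nonneg fun k => abs_nonneg _
    have hB : 0 ≤ ∑ k ∈ Finset.range p, ‖g k‖ := Finset.sum_nonneg fun k _ => norm_nonneg _
    have hzn : ‖Complex.I * (y : ℂ)‖ = |y| := by simp
    have hy0 : 0 < |y| := abs_pos.2 hy
    rcases lt_or_ge |y| δ with hlt | hge
    · have h1 := hnear (Complex.I * y) (by simp) (by simp [hy]) (by rwa [hzn])
      rw [hzn] at h1
      refine h1.trans ?_
      gcongr
      have : 0 ≤ (∑' k, |w k|) / δ ^ (α + p) := by positivity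
      have : 0 ≤ (∑ k ∈ Finset.range p, ‖g k‖) / δ ^ p := by positivity
      linarith
    · have h1 : ‖symbol r w (Complex.I * y)‖ ≤ (∑' k, |w k|) / δ ^ (α + p) * |y| ^ (α + p) := by
        refine (norm_symbol_I_mul_le hsum y).trans ?_
        rw [div_mul_eq_mul_div, le_div_iff₀ (by positivity)]
        gcongr
      have h2 : ‖(Complex.I * (y : ℂ)) ^ (α : ℂ) * T (Complex.I * y)‖ ≤
          (∑ k ∈ Finset.range p, ‖g k‖) / δ ^ p * |y| ^ (α + p) := by
        rw [norm_mul, Complex.norm_cpow_real, hzn, Real.rpow_add hy0, Real.rpow_natCast]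
        have h3 : ‖T (Complex.I * y)‖ ≤ (∑ k ∈ Finset.range p, ‖g k‖) * (|y| ^ p / δ ^ p) := by
          rw [Finset.sum_mul]
          refine norm_sum_le_of_le _ fun k hk => ?_
          rw [norm_mul, norm_pow, hzn, mul_comm]
          gcongr
          exact pow_le_of_le hδ hδ1 hge (Finset.mem_range.1 hk).le
        calc |y| ^ α * ‖T (Complex.I * y)‖
            ≤ |y| ^ α * ((∑ k ∈ Finset.range p, ‖g k‖) * (|y| ^ p / δ ^ p)) := by gcongr
          _ = _ := by ring
      refine (norm_sub_le_of_le h1 h2).trans ?_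
      have : 0 ≤ C₁ * |y| ^ (α + p) := by positivity
      linarith
  · refine IsBigO.of_bound C₁ ?_
    filter_upwards [Ioo_mem_nhdsGT hδ] with x hx
    have hxn : ‖(x : ℂ)‖ = x := by rw [Complex.norm_real, Real.norm_eq_abs, abs_of_pos hx.1]
    have h1 := hnear x (by simpa using hx.1.le) (by exact_mod_cast hx.1.ne') (by rw [hxn]; exact hx.2)
    rw [hxn] at h1
    rwa [Real.norm_eq_abs, abs_of_pos (Real.rpow_pos_of_pos hx.1 _)]

/-! ### Non-integer order: expansion of the error. -/

/-- If it vanished identically, Fourier inversion at the continuity points ω ≠ 0 would make the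
transform of f vanish there, contradicting f(0) = 1. -/
theorem exists_fourierInv_hatPow_ne_zero {a : ℝ} (ha : 0 < a) :
    ∃ f : ℝ → ℝ, (∀ s : ℕ, SmoothL1 s f) ∧ ∃ x, 𝓕⁻ (hatPow a f) x ≠ 0 := by
  obtain ⟨f, hf, hfe⟩ := exists_smooth_eventuallyEq_exp
  refine ⟨f, hf, ?_⟩
  by_contra! h
  obtain ⟨N, hN⟩ := exists_nat_gt (a + 1)
  have hfi : Integrable f := by simpa using (hf 0).2 0 le_rfl
  have hgi : Integrable (hatPow a f) := integrable_hatPow (hf N) (by linarith) (by linarith)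
  have hinv : 𝓕⁻ (hatPow a f) = 0 := funext h
  have hfour : 𝓕 (hatPow a f) = 0 := by
    funext x
    rw [← neg_neg x, ← Real.fourierInv_eq_fourier_neg]
    exact h _
  have hhat : ∀ ω : ℝ, ω ≠ 0 → hat f ω = 0 := by
    intro ω hω
    have hsl := two_pi_I_mul_mem_slitPlane hω
    have hc : ContinuousAt (hatPow a f) ω := by
      refine ContinuousAt.mul ?_ (continuous_hat hfi).continuousAt
      exact ContinuousAt.comp (f := fun ω : ℝ => (2 * Real.pi * Complex.I * ω : ℂ))
        (continuousAt_cpow_const hsl) (by fun_prop)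
    have h1 := hgi.fourier_fourierInv_eq (by rw [hfour]; exact integrable_zero _ _ _) hc
    have h2 : 𝓕 (0 : ℝ → ℂ) ω = 0 := by simp [Real.fourier_eq]
    rw [hinv, h2] at h1
    have h3 : (2 * Real.pi * Complex.I * ω : ℂ) ^ (a : ℂ) ≠ 0 := by
      rw [Ne, Complex.cpow_eq_zero_iff]
      exact fun h => Complex.slitPlane_ne_zero hsl h.1
    exact (mul_eq_zero.1 h1.symm).resolve_left h3
  have h0 : ∀ᵐ ω : ℝ, ω ≠ 0 := by simp [ae_iff, measure_singleton]
  have h1 := fourierInv_hat (hf 2) le_rfl 0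
  rw [fourierInv_eq_integral, integral_eq_zero_of_ae, hfe.self_of_nhds, Real.exp_zero] at h1
  · simp at h1
  · filter_upwards [h0] with ω hω
    simp [hhat ω hω]

/-- With y = 2πωh, the remainder of the multiplier is at most C h^(-α) |y|^(α+p) = C h^p
|2πω|^(α+p), which is integrated against the transform of f. -/
theorem leftDeriv_sub_leftOp_expansion {m n p : ℕ} {α r : ℝ} (hα : 0 < α)
    (hn₁ : (n : ℝ) - 1 < α) (hn₂ : α < n) (hp : 1 ≤ p) (hpm : p ≤ m) {w : ℕ → ℝ}
    (hsum : Summable fun k => |w k|) {g : ℕ → ℂ} {C : ℝ}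
    (hC : ∀ y : ℝ, y ≠ 0 → ‖symbol r w (Complex.I * y) - (Complex.I * y) ^ (α : ℂ) *
        ∑ k ∈ Finset.range p, (Complex.I * y) ^ k * g k‖ ≤ C * |y| ^ (α + p))
    {f : ℝ → ℝ} (hf : SmoothL1 (m + n + 1) f) (x : ℝ) :
    (fun h : ℝ => ((leftDeriv α f x - leftOp α r w h f x : ℝ) : ℂ) -
      ∑ k ∈ Finset.range p, h ^ k • (((if k = 0 then 1 else 0) - g k) *
        𝓕⁻ (hatPow (α + k) f) x)) =O[𝓝[>] 0] fun h : ℝ => h ^ p := by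
  have hn : 1 ≤ n := by
    rcases Nat.eq_zero_or_pos n with rfl | h
    · simp at hn₂; linarith
    · exact h
  have hpm' : (p : ℝ) ≤ m := by exact_mod_cast hpm
  -- The smoothness m + n + 1 is what makes |ω|^(α+p) times the transform integrable, as α < n and p
  -- ≤ m.
  have hdec : α + p - ((m + n + 1 : ℕ) : ℝ) < -1 := by push_cast; linarith
  have hfi : Integrable f := by simpa using hf.2 0 (Nat.zero_le _)
  have hih := integrable_hat hf (by omega)
  have hmh := (continuous_hat hfi).measurable
  have hip := integrable_rpow_mul_norm_hat hf (a := α + p) (by linarith [p.cast_nonneg (α := ℝ)]) hdec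
  have h0 : ∀ᵐ ω : ℝ, ω ≠ 0 := by simp [ae_iff, measure_singleton]
  have hik : ∀ k : ℕ, k ≤ p → Integrable (hatPow (α + k) f) := by
    intro k hk
    have hk' : (k : ℝ) ≤ p := by exact_mod_cast hk
    exact integrable_hatPow hf (by linarith [k.cast_nonneg (α := ℝ)]) (by linarith)
  have hiexp : ∀ u : ℝ → ℂ, Integrable u →
      Integrable fun ω : ℝ => Complex.exp (2 * Real.pi * Complex.I * ω * x) * u ω := by
    intro u hu
    refine hu.norm.mono' ?_ (Eventually.of_forall fun ω => ?_)
    · exact (by fun_prop : Measurable fun ω : ℝ =>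
        Complex.exp (2 * Real.pi * Complex.I * ω * x)).aestronglyMeasurable.mul
          hu.aestronglyMeasurable
    · rw [norm_mul, norm_exp_two_pi_I, one_mul]
  refine IsBigO.of_bound (C * ∫ ω, |2 * Real.pi * ω| ^ (α + p) * ‖hat f ω‖) ?_
  filter_upwards [self_mem_nhdsWithin] with h (hh : 0 < h)
  have hhα : 0 < h ^ α := Real.rpow_pos_of_pos hh _
  set S : ℝ → ℂ := fun ω => ((h ^ α : ℝ) : ℂ)⁻¹ *
      symbol r w (Complex.I * (2 * Real.pi * ω * h : ℝ)) * hat f ω with hS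
  have hSi : Integrable S := by
    have hcS : Continuous fun ω : ℝ => symbol r w (Complex.I * (2 * Real.pi * ω * h : ℝ)) :=
      (continuousOn_symbol (r := r) hsum).comp_continuous (by fun_prop) fun ω => by simp
    refine (hih.norm.const_mul ((h ^ α)⁻¹ * ∑' k, |w k|)).mono' ?_ (Eventually.of_forall fun ω => ?_)
    · exact ((continuous_const.mul hcS).measurable.mul hmh).aestronglyMeasurable
    · rw [hS]
      simp only [norm_mul, norm_inv, Complex.norm_real, Real.norm_eq_abs, abs_of_pos hhα]
      gcongr
      exact norm_symbol_I_mul_le hsum _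
  have hA : ((leftDeriv α f x - leftOp α r w h f x : ℝ) : ℂ) -
      ∑ k ∈ Finset.range p, h ^ k • (((if k = 0 then 1 else 0) - g k) *
        𝓕⁻ (hatPow (α + k) f) x) =
      ∫ ω : ℝ, Complex.exp (2 * Real.pi * Complex.I * ω * x) * (hatPow α f ω - S ω -
        ∑ k ∈ Finset.range p, h ^ k • (((if k = 0 then 1 else 0) - g k) * hatPow (α + k) f ω)) := by
    rw [Complex.ofReal_sub, leftDeriv_eq_fourierInv hn₁ hn₂ hα (by omega) hf,
      ofReal_leftOp_eq_fourierInv hf (by omega) α r hsum]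
    simp only [fourierInv_eq_integral]
    have hi0 : Integrable (hatPow α f) := by simpa using hik 0 (by omega)
    have hi1 := hiexp _ hi0
    have hi2 := hiexp _ hSi
    have hi3 : ∀ k ∈ Finset.range p, Integrable fun ω : ℝ =>
        (h : ℂ) ^ k * ((if k = 0 then 1 else 0) - g k) *
          (Complex.exp (2 * Real.pi * Complex.I * ω * x) * hatPow (α + k) f ω) := fun k hk =>
      (hiexp _ (hik k (Finset.mem_range.1 hk).le)).const_mul _
    rw [← integral_sub hi1 hi2]
    have h3 : ∀ k ∈ Finset.range p, h ^ k • (((if k = 0 then 1 else 0) - g k) *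
        ∫ ω : ℝ, Complex.exp (2 * Real.pi * Complex.I * ω * x) * hatPow (α + k) f ω) =
        ∫ ω : ℝ, (h : ℂ) ^ k * ((if k = 0 then 1 else 0) - g k) *
          (Complex.exp (2 * Real.pi * Complex.I * ω * x) * hatPow (α + k) f ω) := by
      intro k _
      rw [integral_const_mul, Complex.real_smul]
      push_cast
      ring
    have hi12 := hi1.sub hi2
    simp only [Pi.sub_def] at hi12
    rw [Finset.sum_congr rfl h3, ← integral_finsetSum _ hi3,
      ← integral_sub hi12 (integrable_finsetSum _ hi3)]
    refine integral_congr_ae (Eventually.of_forall fun ω => ?_)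
    simp only [mul_sub, Finset.mul_sum]
    congr 1
    refine Finset.sum_congr rfl fun k _ => ?_
    rw [Complex.real_smul]
    push_cast
    ring
  rw [hA, Real.norm_eq_abs, abs_of_pos (pow_pos hh p)]
  calc _ ≤ ∫ ω : ℝ, C * h ^ p * (|2 * Real.pi * ω| ^ (α + p) * ‖hat f ω‖) := by
        refine norm_integral_le_of_norm_le (hip.const_mul _) ?_
        filter_upwards [h0] with ω hω
        rw [norm_mul, norm_exp_two_pi_I, one_mul]
        set ξ : ℂ := 2 * Real.pi * Complex.I * ω with hξ
        have hξ0 : ξ ≠ 0 := Complex.slitPlane_ne_zero (two_pi_I_mul_mem_slitPlane hω)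
        set y : ℝ := 2 * Real.pi * ω * h with hy
        have hy0 : y ≠ 0 := by
          rw [hy]; exact mul_ne_zero (mul_ne_zero Real.two_pi_pos.ne' hω) hh.ne'
        have hIy : Complex.I * (y : ℂ) = h * ξ := by rw [hy, hξ]; push_cast; ring
        -- The principal power splits over this product because h is a positive real.
        have hpow : (Complex.I * (y : ℂ)) ^ (α : ℂ) = ((h ^ α : ℝ) : ℂ) * ξ ^ (α : ℂ) := by
          rw [hIy, Complex.cpow_def_of_ne_zero (mul_ne_zero (by exact_mod_cast hh.ne') hξ0),
            Complex.log_ofReal_mul hh hξ0, add_mul, Complex.exp_add,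
            ← Complex.cpow_def_of_ne_zero hξ0, Real.rpow_def_of_pos hh]
          push_cast
          rfl
        have hhc : ((h ^ α : ℝ) : ℂ) ≠ 0 := by exact_mod_cast hhα.ne'
        have key : hatPow α f ω - S ω - ∑ k ∈ Finset.range p,
            h ^ k • (((if k = 0 then 1 else 0) - g k) * hatPow (α + k) f ω) =
            -(((h ^ α : ℝ) : ℂ)⁻¹ * (symbol r w (Complex.I * y) - (Complex.I * y) ^ (α : ℂ) *
              ∑ k ∈ Finset.range p, (Complex.I * y) ^ k * g k) * hat f ω) := by
          have h4 : ∀ k : ℕ, hatPow (α + k) f ω = ξ ^ (α : ℂ) * ξ ^ k * hat f ω := by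
            intro k
            rw [hatPow, ← hξ]
            push_cast
            rw [Complex.cpow_add _ _ hξ0, Complex.cpow_natCast]
          have h5 : ∑ k ∈ Finset.range p, h ^ k • (((if k = 0 then 1 else 0) - g k) *
              hatPow (α + k) f ω) = hatPow α f ω - ξ ^ (α : ℂ) *
                (∑ k ∈ Finset.range p, (Complex.I * y) ^ k * g k) * hat f ω := by
            have h6 : ∀ k ∈ Finset.range p, h ^ k • (((if k = 0 then 1 else 0) - g k) *
                hatPow (α + k) f ω) = (if k = 0 then hatPow α f ω else 0) -
                  ξ ^ (α : ℂ) * ((Complex.I * y) ^ k * g k) * hat f ω := by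
              intro k _
              rw [h4, hIy, Complex.real_smul, mul_pow]
              split_ifs with hk
              · subst hk
                rw [hatPow, ← hξ]
                push_cast
                ring
              · push_cast
                ring
            rw [Finset.sum_congr rfl h6, Finset.sum_sub_distrib, Finset.mul_sum, Finset.sum_mul]
            simp [show 0 < p by omega]
          rw [h5, hpow, hS]
          simp only
          field_simp
          ring
        rw [key, norm_neg, norm_mul, norm_mul, norm_inv, Complex.norm_real, Real.norm_eq_abs,
          abs_of_pos hhα]
        have h7 : |y| ^ (α + p) = h ^ α * h ^ p * |2 * Real.pi * ω| ^ (α + p) := by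
          rw [hy, abs_mul, abs_of_pos hh, Real.mul_rpow (abs_nonneg _) hh.le, Real.rpow_add hh,
            Real.rpow_natCast]
          ring
        calc _ ≤ (h ^ α)⁻¹ * (C * |y| ^ (α + p)) * ‖hat f ω‖ := by
              gcongr
              exact hC y hy0
          _ = _ := by
              rw [h7]
              field_simp
    _ = _ := by
        rw [integral_const_mul]
        ring

/-- Both sides are equivalent to g_k = δ_{k,0} for k < p. For each k a test function with
nonvanishing D^(α+k) f at some point isolates g_k. -/
theorem approximatesLeft_iff_of_lt {m n p : ℕ} {α r : ℝ} (hα : 0 < α)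
    (hn₁ : (n : ℝ) - 1 < α) (hn₂ : α < n) (hp : 1 ≤ p) (hpm : p ≤ m) {w : ℕ → ℝ}
    (hsum : Summable fun k => |w k|) (hG : HasAnalyticSymbol α r w) :
    ApproximatesLeft α r w p (m + n + 1) ↔
      (fun x => realSymbol r w x - x ^ α) =O[𝓝[>] 0] fun x : ℝ => x ^ (α + p) := by
  obtain ⟨g, ⟨C, hC⟩, hg⟩ := exists_symbol_expansion hα hsum hG p
  have hexp := fun (f : ℝ → ℝ) (hf : SmoothL1 (m + n + 1) f) (x : ℝ) =>
    leftDeriv_sub_leftOp_expansion hα hn₁ hn₂ hp hpm hsum hC hf x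
  have hleft : ApproximatesLeft α r w p (m + n + 1) ↔
      ∀ k < p, g k = if k = 0 then 1 else 0 := by
    constructor
    · intro hA k hk
      obtain ⟨f, hf, x, hx⟩ := exists_fourierInv_hatPow_ne_zero (a := α + k) (by positivity)
      have h1 : (fun h : ℝ => ((leftDeriv α f x - leftOp α r w h f x : ℝ) : ℂ)) =O[𝓝[>] 0]
          fun h : ℝ => h ^ p := by
        refine (IsBigO.congr_left ?_ fun _ => rfl)
        exact isBigO_norm_left.1 (by
          simpa only [Complex.norm_real] using (hA f (hf _) x).2.norm_left)
      have h2 := (h1.sub (hexp f (hf _) x)).congr_left fun h => sub_sub_cancel _ _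
      have h3 := eq_zero_of_sum_pow_smul_isBigO p _ h2 k hk
      exact (sub_eq_zero.1 ((mul_eq_zero.1 h3).resolve_right hx)).symm
    · intro hk f hf x
      constructor
      · refine Eventually.of_forall fun h => Summable.of_norm_bounded
          (g := fun k => |w k| * ∫ ω, ‖hat f ω‖) (hsum.mul_right _) fun k => ?_
        rw [norm_mul, Real.norm_eq_abs, Real.norm_eq_abs]
        gcongr
        exact abs_le_integral_hat hf (by omega) _
      · have h1 : (fun h : ℝ => ((leftDeriv α f x - leftOp α r w h f x : ℝ) : ℂ)) =O[𝓝[>] 0]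
            fun h : ℝ => h ^ p := by
          refine (hexp f hf x).congr_left fun h => ?_
          rw [Finset.sum_eq_zero, sub_zero]
          intro k hkp
          rw [hk k (Finset.mem_range.1 hkp), sub_self, zero_mul, smul_zero]
        simpa only [Complex.norm_real, isBigO_norm_left] using h1.norm_left
  have hcast : ∀ x : ℝ, 0 < x → (x : ℂ) ^ (α : ℂ) = ((x ^ α : ℝ) : ℂ) := fun x hx =>
    (Complex.ofReal_cpow hx.le α).symm
  have hright : ((fun x => realSymbol r w x - x ^ α) =O[𝓝[>] 0] fun x : ℝ => x ^ (α + p)) ↔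
      ∀ k < p, g k = if k = 0 then 1 else 0 := by
    have hC' : ((fun x => realSymbol r w x - x ^ α) =O[𝓝[>] 0] fun x : ℝ => x ^ (α + p)) ↔
        (fun x : ℝ => symbol r w x - ((x ^ α : ℝ) : ℂ)) =O[𝓝[>] 0] fun x : ℝ => x ^ (α + p) := by
      rw [← isBigO_norm_left, ← isBigO_norm_left (f' := fun x : ℝ => symbol r w x - _)]
      simp only [symbol_ofReal, ← Complex.ofReal_sub, Complex.norm_real]
    rw [hC']
    constructor
    · intro h k hk
      have h1 := (isBigO_refl (fun x : ℝ => (x ^ α)⁻¹) (𝓝[>] 0)).smul (h.sub hg)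
      have h2 : (fun x : ℝ => ∑ k ∈ Finset.range p, x ^ k • (g k - if k = 0 then 1 else 0))
          =O[𝓝[>] 0] fun x : ℝ => x ^ p := by
        refine h1.congr' ?_ ?_
        · filter_upwards [self_mem_nhdsWithin] with x (hx : 0 < x)
          have hxα : ((x ^ α : ℝ) : ℂ) ≠ 0 := by
            exact_mod_cast (Real.rpow_pos_of_pos hx α).ne'
          rw [hcast x hx, Complex.real_smul]
          have h3 : ∑ k ∈ Finset.range p, x ^ k • (g k - if k = 0 then 1 else 0) =
              ∑ k ∈ Finset.range p, (x : ℂ) ^ k * g k - 1 := by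
            simp only [Complex.real_smul, mul_sub, Finset.sum_sub_distrib]
            simp [show 0 < p by omega]
          rw [h3]
          push_cast
          field_simp
          ring
        · filter_upwards [self_mem_nhdsWithin] with x (hx : 0 < x)
          have := Real.rpow_pos_of_pos hx α
          rw [Real.rpow_add hx, Real.rpow_natCast, smul_eq_mul]
          field_simp
      exact sub_eq_zero.1 (eq_zero_of_sum_pow_smul_isBigO p _ h2 k hk)
    · intro h
      refine hg.congr' ?_ EventuallyEq.rfl
      filter_upwards [self_mem_nhdsWithin] with x (hx : 0 < x)
      rw [hcast x hx, Finset.sum_congr rfl fun k hk => by rw [h k (Finset.mem_range.1 hk)]]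
      simp [show 0 < p by omega]
  rw [hleft, hright]

/-! ### Reflection to the right derivative, and the theorem. -/

theorem smoothL1_comp_neg {s : ℕ} {f : ℝ → ℝ} (hf : SmoothL1 s f) :
    SmoothL1 s fun x => f (-x) := by
  refine ⟨hf.1.comp contDiff_neg, fun k hk => ?_⟩
  refine (((hf.2 k hk).comp_neg).const_mul ((-1) ^ k)).congr (Eventually.of_forall fun x => ?_)
  simp [iteratedDeriv_comp_neg]

theorem rightDeriv_eq_leftDeriv_comp_neg (α : ℝ) (f : ℝ → ℝ) (x : ℝ) :
    rightDeriv α f x = leftDeriv α (fun y => f (-y)) (-x) := by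
  have h : ∀ e y : ℝ, ∫ η in Set.Ioi y, f η / (η - y) ^ e =
      ∫ η in Set.Iio (-y), f (-η) / (-y - η) ^ e := by
    intro e y
    have h1 := integral_comp_neg_Ioi y fun η => f (-η) / (-y - η) ^ e
    rw [← integral_Iic_eq_integral_Iio, ← h1]
    refine setIntegral_congr_fun measurableSet_Ioi fun η _ => ?_
    rw [neg_neg, show -y - -η = η - y by ring]
  rw [rightDeriv, leftDeriv]
  simp only [h]
  rw [iteratedDeriv_comp_neg (⌊α⌋₊ + 1) fun y => ∫ η in Set.Iio y, f (-η) /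
    (y - η) ^ (α + 1 - ((⌊α⌋₊ + 1 : ℕ) : ℝ)), smul_eq_mul, ← mul_assoc]
  congr 1
  rw [div_mul_eq_mul_div, ← mul_pow]
  simp

theorem rightOp_eq_leftOp_comp_neg (α r : ℝ) (w : ℕ → ℝ) (h : ℝ) (f : ℝ → ℝ) (x : ℝ) :
    rightOp α r w h f x = leftOp α r w h (fun y => f (-y)) (-x) := by
  rw [rightOp, leftOp]
  congr 1
  refine tsum_congr fun k => ?_
  ring_nf

theorem approximatesRight_iff_approximatesLeft (α r : ℝ) (w : ℕ → ℝ) (p s : ℕ) :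
    ApproximatesRight α r w p s ↔ ApproximatesLeft α r w p s := by
  have harg : ∀ (x h : ℝ) (k : ℕ), -(-x - ((k : ℝ) - r) * h) = x + ((k : ℝ) - r) * h :=
    fun x h k => by ring
  constructor
  · intro H f hf x
    have h1 := H _ (smoothL1_comp_neg hf) (-x)
    simp only [rightDeriv_eq_leftDeriv_comp_neg, rightOp_eq_leftOp_comp_neg, neg_neg, ← harg] at h1
    exact h1
  · intro H f hf x
    have h1 := H _ (smoothL1_comp_neg hf) (-x)
    simp only [harg, ← rightDeriv_eq_leftDeriv_comp_neg, ← rightOp_eq_leftOp_comp_neg] at h1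
    exact h1

end GrunwaldApprox

theorem theorem3p1 (α r : ℝ) (hα : 0 < α) (m n p : ℕ)
    (hn₁ : (n : ℝ) - 1 < α) (hn₂ : α ≤ n) (hnm : n < m) (hp : 1 ≤ p) (hpm : p ≤ m)
    (β : Fin (p + 1) → ℝ) (w : ℕ → ℝ)
    (hsum : Summable fun k => |w k|)
    (hW : GrunwaldApprox.IsPowerGF α β w)
    (hG : GrunwaldApprox.HasAnalyticSymbol α r w) :
    (GrunwaldApprox.ApproximatesLeft α r w p (m + n + 1) ↔
      ∀ i : ℕ, i ≤ p → ∑ j : Fin (p + 1), (r / α - ((j : ℕ) : ℝ)) ^ i * β j = if i = 1 then (1 : ℝ) else 0) ∧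
    (GrunwaldApprox.ApproximatesRight α r w p (m + n + 1) ↔
      ∀ i : ℕ, i ≤ p → ∑ j : Fin (p + 1), (r / α - ((j : ℕ) : ℝ)) ^ i * β j = if i = 1 then (1 : ℝ) else 0) ∧
    ((∀ i : ℕ, i ≤ p →
        ∑ j : Fin (p + 1), (r / α - ((j : ℕ) : ℝ)) ^ i * β j = if i = 1 then (1 : ℝ) else 0) ↔
      Matrix.mulVec (Matrix.vandermonde fun j : Fin (p + 1) => r / α - ((j : ℕ) : ℝ)).transpose β =
        fun i : Fin (p + 1) => if (i : ℕ) = 1 then (1 : ℝ) else 0) := by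
  have hleft : GrunwaldApprox.ApproximatesLeft α r w p (m + n + 1) ↔
      ∀ i : ℕ, i ≤ p → ∑ j : Fin (p + 1), (r / α - ((j : ℕ) : ℝ)) ^ i * β j =
        if i = 1 then (1 : ℝ) else 0 := by
    rw [← GrunwaldApprox.realSymbol_isBigO_iff hα hp hW]
    -- As n - 1 < α, the strict case is exactly that of non-integer α.
    rcases hn₂.lt_or_eq with hlt | rfl
    · exact GrunwaldApprox.approximatesLeft_iff_of_lt hα hn₁ hlt hp hpm hsum hG
    · obtain ⟨K, hK⟩ := GrunwaldApprox.exists_weights_eventually_zero hsum hW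
      exact GrunwaldApprox.approximatesLeft_natCast_iff hp hpm hK
  refine ⟨hleft, (GrunwaldApprox.approximatesRight_iff_approximatesLeft α r w p _).trans hleft, ?_⟩
  -- `Matrix.vandermonde` indexes nodes by rows and exponents by columns, hence the transpose.
  rw [funext_iff]
  constructor
  · intro h i
    rw [← h i (by omega)]
    simp [Matrix.mulVec, dotProduct, Matrix.vandermonde_apply]
  · intro h i hi
    have h1 := h ⟨i, by omega⟩
    simpa [Matrix.mulVec, dotProduct, Matrix.vandermonde_apply] using h1
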